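/- **Setting.** A DNN $f:\mathbb R^m\to\mathbb R^n$ is a composition of affine layers $x\mapsto Wx+b$ and ReLU layers. $f'$ has the same sequence of layers as $f$, with arbitrary other weights and biases. The input set is $X=\{x: lo\le x\le hi,\ Ax\le b\}$ and the negation of the output property is a system of linear inequalities, $\neg P=\{y: Cy\le d\}$, $P=\mathbb R^n\setminus\neg P$. The property $(f,X,P)$ holds iff $f(x)\in P$ for all $x\in X$. **Encoding.** The variables are all neurons and one slack variable for each of the linear forms $\sum_j W_{ij}x_j-x_i$ (affine neuron $x_i$; value fixed to $-b_i$), $x_j-x_i$ (ReLU relation $x_j=\mathrm{ReLU}(x_i)$; lower bound $0$), and the left sides of the inequalities in $X$ and $\neg P$ (upper bound the right side). A configuration is $\mathsf{SAT}$, $\mathsf{UNSAT}$, or $(\mathcal B,T,R,l,u,\alpha)$: basic variables, a tableau of equations $x_i=\sum_{x_j\notin\mathcal B}a_{ij}x_j$ ($x_i\in\mathcal B$), the ReLU pairs, bounds, and an assignment. For a set $A$ of assertions $x\ge0$, $x\le0$ on neurons, $\mathbf{DeepPoly}(f,X\wedge A)$ denotes the bounds that DeepPoly (back-substitution of symbolic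 bounds to the input box, bounds clipped by $A$) gives to the neurons, extended to the slack variables. The initial configuration of $f$ has these bounds for $A=\varnothing$ and the tableau of the linear forms, transformed by Gauss elimination to heuristically chosen basic variables. **Reluplex.** A local search is a finite sequence of steps, each of which pivots, changes the non-basic values of $\alpha$ (the basic ones follow from $T$), or, for a pair $x_j=\mathrm{ReLU}(x_i)$ with $l(x_i)\ge0$ (resp. $u(x_i)\le0$), refines the bounds by $x_j-x_i\le0$ (resp. $x_j=0$). Then either $\mathsf{SAT}$ is concluded, if $\alpha$ satisfies $T$, $R$, $l$, $u$; or $\mathsf{UNSAT}$ is concluded, if some equation of $T$ satisfies $l(x_i)>\sum_{x_j\notin\mathcal B}(\max(a_{ij},0)u(x_j)+\min(a_{ij},0)l(x_j))$ or $u(x_i)<\sum_{x_j\notin\mathcal B}(\max(a_{ij},0)l(x_j)+\min(a_{ij},0)u(x_j))$, or if $l(x)>u(x)$ for some variable $x$; or the search splits on a ReLU argument $x$ with $l(x)<0<u(x)$ into the branches $x\le0$ and $x\ge0$, with bounds intersected with those of DeepPoly under all assertions made so far. The output is $\mathsf{SAT}$ as soon as one branch is $\mathsf{SAT}$ (branches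 not visited are labelled with the empty sequence $\varepsilon$), and $\mathsf{UNSAT}$ if all branches are. Such a complete finite search is recorded as a binary tree whose edges carry the assertions and whose nodes carry the sequences of configurations: a *Reluplex solving procedure*. $\mathbf{Reluplex}$ is any implementation of this search: on every configuration from which some complete finite search exists it ends, with the output of a complete finite search; all heuristic choices are arbitrary. **Algorithm.** Input: a Reluplex solving procedure $\mathcal T$ of $(f,X,P)$, started from an initial configuration of $f$, and $f'$. For a leaf $v$, $\mathbf{Assert}(v)$ is the set of assertions on the path to $v$, and $L(v){\downarrow}$ is the last configuration of its label that is not $\mathsf{SAT}$ or $\mathsf{UNSAT}$; if the label is $\varepsilon$, then $L(v){\downarrow}$ is the initial configuration $\mathcal C_0$ of $f'$. 1. Let $U$ be the concretization of the DeepPoly abstraction of $f'$ on $X$ (all neuron values within its numerical and symbolic bounds). If $U\wedge\neg P$ is empty, return $\mathsf{UNSAT}$. Otherwise form $\mathcal C_0$, and delete from $\mathcal T$ every edge whose assertion is disjoint from $U$, with the subtree below it. 2. If the given $\mathcal T$ has a $\mathsf{SAT}$ leaf, go through the remaining leaves $v$ labelled with $\mathsf{SAT}$ or $\varepsilon$,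 in the order of the size of the symmetric difference of $\mathbf{Assert}(v)$ with the assertions of the $\mathsf{SAT}$ leaf. Call $\mathbf{Reluplex}$ on $L(v){\downarrow}$ with bounds replaced by $\mathbf{DeepPoly}(f',X\wedge\mathbf{Assert}(v))$ and tableau replaced by that of $\mathcal C_0$ after Gauss elimination to the basic variables of $L(v){\downarrow}$ (as far as these can be made basic). If the answer is $\mathsf{SAT}$, return $\mathsf{SAT}$. 3. For every remaining $\mathsf{UNSAT}$ leaf $v$: consider the linear program given by $f'\wedge X\wedge\neg P\wedge\mathbf{Assert}(v)$ with the bounds $\mathbf{DeepPoly}(f',X\wedge\mathbf{Assert}(v))$, where an undecided relation $x_j=\mathrm{ReLU}(x_i)$, $l_i<0<u_i$, is relaxed to $x_j\ge0$, $x_j\ge x_i$, $x_j\le u_i(x_i-l_i)/(u_i-l_i)$. If it is infeasible, the leaf is $\mathsf{UNSAT}$. Otherwise replace the bounds of the variables in the equation of $L(v){\downarrow}$ that inferred $\mathsf{UNSAT}$ (if there is one) by their minima and maxima over the linear program, and transform the tableau as in 2. If the equation with the same basic variable in the new tableau infers $\mathsf{UNSAT}$, the leaf is $\mathsf{UNSAT}$;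 otherwise its answer is that of $\mathbf{Reluplex}$ on the resulting configuration. If the answer is $\mathsf{SAT}$, return $\mathsf{SAT}$. 4. Return $\mathsf{UNSAT}$. **Theorem.** For all $f$, $f'$, $X$, $P$ as above, every Reluplex solving procedure $\mathcal T$ of $(f,X,P)$ and every implementation of $\mathbf{Reluplex}$, the algorithm is sound and complete: it returns $\mathsf{UNSAT}$ if and only if the property $(f',X,P)$ holds (and $\mathsf{SAT}$ otherwise). -/

import Mathlib

namespace IncSMT

noncomputable section

open scoped Classical

/-! ## ReLU networks -/

/-- The structure of a feed-forward network with `m` inputs: a sequence of layers, each of which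
is an affine layer (of any width) or a ReLU layer (of the width of the previous layer).
`Arch m n` has `n` neurons in its last layer. -/
inductive Arch (m : ℕ) : ℕ → Type
  | input : Arch m m
  | affine {k : ℕ} (g : Arch m k) (n : ℕ) : Arch m n
  | relu {k : ℕ} (g : Arch m k) : Arch m k

variable {m n : ℕ}

/-- A network of structure `a`: a weight matrix and a bias vector for every affine layer. -/
inductive DNN {m : ℕ} : {n : ℕ} → Arch m n → Type
  | input : DNN Arch.input
  | affine {k n : ℕ} {g : Arch m k} (f : DNN g) (W : Matrix (Fin n) (Fin k) ℝ) (b : Fin n → ℝ) :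
      DNN (Arch.affine g n)
  | relu {k : ℕ} {g : Arch m k} (f : DNN g) : DNN (Arch.relu g)

/-- The function `ℝ^m → ℝ^n` computed by a network. -/
def DNN.eval {n : ℕ} {a : Arch m n} : DNN a → (Fin m → ℝ) → (Fin n → ℝ)
  | .input, x => x
  | .affine f W b, x => fun i => ∑ j, W i j * f.eval x j + b i
  | .relu f, x => fun i => max 0 (f.eval x i)

/-- The neurons of all layers. -/
def Neuron : {n : ℕ} → Arch m n → Type
  | _, .input => Fin m
  | _, .affine g n => Neuron g ⊕ Fin n
  | _, .relu (k := k) g => Neuron g ⊕ Fin k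

instance instFintypeNeuron : {n : ℕ} → (a : Arch m n) → Fintype (Neuron a)
  | _, .input => inferInstanceAs (Fintype (Fin m))
  | _, .affine g n =>
      letI := instFintypeNeuron g
      inferInstanceAs (Fintype (Neuron g ⊕ Fin n))
  | _, .relu (k := k) g =>
      letI := instFintypeNeuron g
      inferInstanceAs (Fintype (Neuron g ⊕ Fin k))

/-- The `i`-th input neuron. -/
def inN : {n : ℕ} → (a : Arch m n) → Fin m → Neuron a
  | _, .input, i => i
  | _, .affine g _, i => Sum.inl (inN g i)
  | _, .relu g, i => Sum.inl (inN g i)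

/-- The `i`-th neuron of the last layer. -/
def outN : {n : ℕ} → (a : Arch m n) → Fin n → Neuron a
  | _, .input, i => i
  | _, .affine _ _, i => Sum.inr i
  | _, .relu _, i => Sum.inr i

/-- The neurons of the affine layers. -/
def AffIdx : {n : ℕ} → Arch m n → Type
  | _, .input => Empty
  | _, .affine g n => AffIdx g ⊕ Fin n
  | _, .relu g => AffIdx g

instance instFintypeAffIdx : {n : ℕ} → (a : Arch m n) → Fintype (AffIdx a)
  | _, .input => inferInstanceAs (Fintype Empty)
  | _, .affine g n =>
      letI := instFintypeAffIdx g
      inferInstanceAs (Fintype (AffIdx g ⊕ Fin n))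
  | _, .relu g => instFintypeAffIdx g

/-- The ReLU relations of a network, one for each neuron of a ReLU layer. -/
def ReluIdx : {n : ℕ} → Arch m n → Type
  | _, .input => Empty
  | _, .affine g _ => ReluIdx g
  | _, .relu (k := k) g => ReluIdx g ⊕ Fin k

instance instFintypeReluIdx : {n : ℕ} → (a : Arch m n) → Fintype (ReluIdx a)
  | _, .input => inferInstanceAs (Fintype Empty)
  | _, .affine g _ => instFintypeReluIdx g
  | _, .relu (k := k) g =>
      letI := instFintypeReluIdx g
      inferInstanceAs (Fintype (ReluIdx g ⊕ Fin k))

/-- The neuron `x_i` of the relation `x_j = ReLU(x_i)`. -/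
def pre : {n : ℕ} → {a : Arch m n} → ReluIdx a → Neuron a
  | _, .input => Empty.elim
  | _, .affine g _ => fun r => Sum.inl (pre (a := g) r)
  | _, .relu g => Sum.elim (fun r => Sum.inl (pre (a := g) r)) (fun i => Sum.inl (outN g i))

/-- The neuron `x_j` of the relation `x_j = ReLU(x_i)`. -/
def post : {n : ℕ} → {a : Arch m n} → ReluIdx a → Neuron a
  | _, .input => Empty.elim
  | _, .affine g _ => fun r => Sum.inl (post (a := g) r)
  | _, .relu g => Sum.elim (fun r => Sum.inl (post (a := g) r)) (fun i => Sum.inr i)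

/-- The linear form `∑ⱼ Wᵢⱼ xⱼ - xᵢ` of the affine neuron `xᵢ = ∑ⱼ Wᵢⱼ xⱼ + bᵢ`. -/
def affCoeff : {n : ℕ} → {a : Arch m n} → DNN a → AffIdx a → Neuron a → ℝ
  | _, _, .input => Empty.elim
  | _, _, .affine (g := g) f W _ =>
      Sum.elim (fun e => Sum.elim (affCoeff f e) (fun _ => 0))
        (fun i => Sum.elim (fun μ => ∑ j, if μ = outN g j then W i j else 0)
          (fun i' => if i' = i then -1 else 0))
  | _, _, .relu f => fun e => Sum.elim (affCoeff f e) (fun _ => 0)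

/-- The bias `bᵢ` of the affine neuron `xᵢ = ∑ⱼ Wᵢⱼ xⱼ + bᵢ`. -/
def affBias : {n : ℕ} → {a : Arch m n} → DNN a → AffIdx a → ℝ
  | _, _, .input => Empty.elim
  | _, _, .affine f _ b => Sum.elim (affBias f) b
  | _, _, .relu f => fun e => affBias f e

/-! ## Safety properties -/

/-- The safety property `(f, X, P)` holds. -/
def SafetyHolds (f : (Fin m → ℝ) → (Fin n → ℝ)) (X : Set (Fin m → ℝ)) (P : Set (Fin n → ℝ)) :
    Prop :=
  ∀ x ∈ X, f x ∈ P

/-- The constraints that describe the input set and the negation of the output property: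
an input box with further linear inequalities, and a system of linear inequalities on the
output. -/
structure Spec (m n : ℕ) where
  lo : Fin m → ℝ
  hi : Fin m → ℝ
  p : ℕ
  inMat : Matrix (Fin p) (Fin m) ℝ
  inVec : Fin p → ℝ
  q : ℕ
  outMat : Matrix (Fin q) (Fin n) ℝ
  outVec : Fin q → ℝ

/-- The input set. -/
def Spec.X (S : Spec m n) : Set (Fin m → ℝ) :=
  {x | (∀ i, S.lo i ≤ x i ∧ x i ≤ S.hi i) ∧ ∀ k, ∑ i, S.inMat k i * x i ≤ S.inVec k}

/-- The negation `¬P` of the output property. -/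
def Spec.negP (S : Spec m n) : Set (Fin n → ℝ) :=
  {y | ∀ k, ∑ i, S.outMat k i * y i ≤ S.outVec k}

/-- The output property. -/
def Spec.P (S : Spec m n) : Set (Fin n → ℝ) := S.negPᶜ

/-! ## Assertions -/

/-- The two kinds of assertions: `active` is `x ≥ 0`, `inactive` is `x ≤ 0`. -/
inductive Phase
  | active
  | inactive

/-- An assertion `x ≥ 0` or `x ≤ 0` on a neuron. -/
abbrev Assertion (a : Arch m n) : Type := Neuron a × Phase

/-- The values `x` of the neurons satisfy the assertion. -/
def Assertion.Sat {a : Arch m n} : Assertion a → (Neuron a → ℝ) → Prop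
  | (ν, .active), x => 0 ≤ x ν
  | (ν, .inactive), x => x ν ≤ 0

/-! ## DeepPoly -/

/-- The least value of `∑ⱼ cⱼ xⱼ` on the box `l ≤ x ≤ u`. -/
def boxMin {ι : Type} [Fintype ι] (c l u : ι → ℝ) : ℝ :=
  ∑ j, (max (c j) 0 * l j + min (c j) 0 * u j)

/-- A lower bound `l` of the neuron `ν`, improved by the assertions `A`. -/
def clipL {N : Type} (A : Set (N × Phase)) (ν : N) (l : ℝ) : ℝ :=
  if (ν, Phase.active) ∈ A then max l 0 else l

/-- An upper bound `u` of the neuron `ν`, improved by the assertions `A`. -/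
def clipU {N : Type} (A : Set (N × Phase)) (ν : N) (u : ℝ) : ℝ :=
  if (ν, Phase.inactive) ∈ A then min u 0 else u

/-- The slope `s` of the DeepPoly lower bound `ReLU(x) ≥ s * x` on `[l, u]`. -/
def lowSlope (l u : ℝ) : ℝ :=
  if 0 ≤ l then 1 else if u ≤ 0 then 0 else if -l < u then 1 else 0

/-- The slope `s` of the DeepPoly upper bound `ReLU(x) ≤ s * x + t` on `[l, u]`. -/
def upSlope (l u : ℝ) : ℝ :=
  if 0 ≤ l then 1 else if u ≤ 0 then 0 else u / (u - l)

/-- The constant `t` of the DeepPoly upper bound `ReLU(x) ≤ s * x + t` on `[l, u]`. -/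
def upConst (l u : ℝ) : ℝ :=
  if 0 ≤ l then 0 else if u ≤ 0 then 0 else -(u * l) / (u - l)

/-- What DeepPoly computes for a network: numerical bounds of all neurons and, for
linear expressions `∑ᵢ cᵢ yᵢ + d` in the neurons `y` of the last layer, the lower bound
`lower c d` obtained by substituting the symbolic bounds back to the input layer. -/
structure Poly (a : Arch m n) where
  lower : (Fin n → ℝ) → ℝ → ℝ
  l : Neuron a → ℝ
  u : Neuron a → ℝ

/-- The DeepPoly abstraction of a network on the input box `[lo, hi]`, restricted to the
assertions `A`. -/
def deepPoly : {n : ℕ} → {a : Arch m n} → DNN a → (lo hi : Fin m → ℝ) →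
    Set (Neuron a × Phase) → Poly a
  | _, _, .input, lo, hi, A =>
      { lower := fun c d =>
          boxMin c (fun i => clipL A i (lo i)) (fun i => clipU A i (hi i)) + d
        l := fun i => clipL A i (lo i)
        u := fun i => clipU A i (hi i) }
  | _, _, .affine (n := n) f W b, lo, hi, A =>
      let D := deepPoly f lo hi {p | (Sum.inl p.1, p.2) ∈ A}
      let low : (Fin n → ℝ) → ℝ → ℝ := fun c d =>
        D.lower (fun j => ∑ i, c i * W i j) (d + ∑ i, c i * b i)
      { lower := low
        l := Sum.elim D.l (fun i => clipL A (Sum.inr i) (low (Pi.single i 1) 0))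
        u := Sum.elim D.u (fun i => clipU A (Sum.inr i) (-low (Pi.single i (-1)) 0)) }
  | _, _, .relu (k := k) (g := g) f, lo, hi, A =>
      let D := deepPoly f lo hi {p | (Sum.inl p.1, p.2) ∈ A}
      let l : Fin k → ℝ := fun i => D.l (outN g i)
      let u : Fin k → ℝ := fun i => D.u (outN g i)
      { lower := fun c d =>
          D.lower
            (fun i => c i * if 0 ≤ c i then lowSlope (l i) (u i) else upSlope (l i) (u i))
            (d + ∑ i, if 0 ≤ c i then 0 else c i * upConst (l i) (u i))
        l := Sum.elim D.l (fun i => clipL A (Sum.inr i) (lowSlope (l i) (u i) * l i))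
        u := Sum.elim D.u (fun i => clipU A (Sum.inr i) (if u i ≤ 0 then 0 else u i)) }

/-- The concretization of the DeepPoly abstraction of `f` on the input set: all values of the
neurons within the numerical bounds and the symbolic bounds. -/
def deepPolySet {a : Arch m n} (f : DNN a) (S : Spec m n) : Set (Neuron a → ℝ) :=
  let D := deepPoly f S.lo S.hi ∅
  {x | (∀ ν, D.l ν ≤ x ν ∧ x ν ≤ D.u ν) ∧
    (∀ e, ∑ ν, affCoeff f e ν * x ν = -affBias f e) ∧
    ∀ r, lowSlope (D.l (pre r)) (D.u (pre r)) * x (pre r) ≤ x (post r) ∧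
      x (post r) ≤ upSlope (D.l (pre r)) (D.u (pre r)) * x (pre r)
        + upConst (D.l (pre r)) (D.u (pre r))}

/-! ## Reluplex configurations -/

section Configurations

variable {𝒳 : Type} [Fintype 𝒳]

/-- A set of basic variables and a tableau of the equations `xᵢ = ∑_{j ∉ basic} coeff i j * xⱼ`
for `i ∈ basic`; the other entries of `coeff` have no meaning. -/
structure Tableau (𝒳 : Type) where
  basic : Finset 𝒳
  coeff : 𝒳 → 𝒳 → ℝ

/-- The right hand side of the equation of `xᵢ`. -/
def Tableau.rhs (t : Tableau 𝒳) (i : 𝒳) (x : 𝒳 → ℝ) : ℝ :=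
  ∑ j ∈ t.basicᶜ, t.coeff i j * x j

/-- The assignment `x` satisfies all equations of the tableau. -/
def Tableau.Sat (t : Tableau 𝒳) (x : 𝒳 → ℝ) : Prop :=
  ∀ i ∈ t.basic, x i = t.rhs i x

/-- The assignment with the non-basic values of `x` whose basic values follow the tableau. -/
def Tableau.extend (t : Tableau 𝒳) (x : 𝒳 → ℝ) : 𝒳 → ℝ :=
  fun i => if i ∈ t.basic then t.rhs i x else x i

/-- The pivot operation: solve the equation of the basic variable `i` for the non-basic
variable `k`, and substitute `k` in the other equations. -/
def Tableau.pivot (t : Tableau 𝒳) (i k : 𝒳) : Tableau 𝒳 where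
  basic := insert k (t.basic.erase i)
  coeff p j :=
    let rowk : ℝ := if j = i then 1 / t.coeff i k else -(t.coeff i j / t.coeff i k)
    if p = k then rowk else (if j = i then 0 else t.coeff p j) + t.coeff p k * rowk

/-- One step of Gauss elimination: make `x` basic in place of a variable outside of
`target`, if there is such a variable whose equation contains `x`. -/
def Tableau.enter (target : Finset 𝒳) (t : Tableau 𝒳) (x : 𝒳) : Tableau 𝒳 :=
  if x ∈ t.basic then t
  else if h : ∃ i ∈ t.basic, i ∉ target ∧ t.coeff i x ≠ 0 then t.pivot h.choose x
  else t

/-- Gauss elimination: transform the tableau into the form whose basic variables are those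
of `target`, as far as `target` can be a set of basic variables of these equations. -/
def Tableau.gauss (t : Tableau 𝒳) (target : Finset 𝒳) : Tableau 𝒳 :=
  target.toList.foldl (Tableau.enter target) t

/-- Equation `i` of the tableau and the numerical bounds `l`, `u` infer `UNSAT`. -/
def Tableau.Conflict (t : Tableau 𝒳) (l u : 𝒳 → ℝ) (i : 𝒳) : Prop :=
  i ∈ t.basic ∧
    (l i > ∑ j ∈ t.basicᶜ, (max (t.coeff i j) 0 * u j + min (t.coeff i j) 0 * l j) ∨
      u i < ∑ j ∈ t.basicᶜ, (max (t.coeff i j) 0 * l j + min (t.coeff i j) 0 * u j))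

/-- A configuration `(ℬ, T, R, l, u, α)` that is not `SAT` or `UNSAT`. -/
structure State (𝒳 : Type) where
  tab : Tableau 𝒳
  R : Set (𝒳 × 𝒳)
  l : 𝒳 → ℝ
  u : 𝒳 → ℝ
  α : 𝒳 → ℝ

/-- A configuration. -/
inductive Config (𝒳 : Type)
  | sat : Config 𝒳
  | unsat : Config 𝒳
  | state (C : State 𝒳) : Config 𝒳

/-- The current assignment satisfies all the constraints. -/
def State.IsSat (C : State 𝒳) : Prop :=
  C.tab.Sat C.α ∧ (∀ p ∈ C.R, C.α p.2 = max 0 (C.α p.1)) ∧ ∀ x, C.l x ≤ C.α x ∧ C.α x ≤ C.u x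

/-- `UNSAT` is inferred: from an equation and the numerical bounds, or since the range of a
variable is empty. -/
def State.IsUnsat (C : State 𝒳) : Prop :=
  (∃ i, C.tab.Conflict C.l C.u i) ∨ ∃ x, C.u x < C.l x

/-- The (basic variable of the) equation that infers `UNSAT`, if there is one. -/
def State.star (C : State 𝒳) : Option 𝒳 :=
  if h : ∃ i, C.tab.Conflict C.l C.u i then some h.choose else none

/-- The variables of the equation that infers `UNSAT`. -/
def State.starVars (C : State 𝒳) : Set 𝒳 :=
  {x | ∃ i, C.star = some i ∧ (x = i ∨ (x ∉ C.tab.basic ∧ C.tab.coeff i x ≠ 0))}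

end Configurations

/-- The answers of the solvers. -/
inductive Answer
  | sat
  | unsat

/-! ## The Reluplex encoding of a network and a specification -/

variable {a : Arch m n} {S : Spec m n}

/-- The linear forms of the encoding: for every affine neuron `xᵢ` the form `∑ⱼ Wᵢⱼ xⱼ - xᵢ`, for
every ReLU relation `xⱼ = ReLU(xᵢ)` the form `xⱼ - xᵢ`, and the forms of the inequalities on the
input and on the output. Each has a slack variable. -/
abbrev Row (a : Arch m n) (S : Spec m n) : Type := AffIdx a ⊕ ReluIdx a ⊕ Fin S.p ⊕ Fin S.q

/-- The variables of the encoding: the neurons and the slack variables. -/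
abbrev Var (a : Arch m n) (S : Spec m n) : Type := Neuron a ⊕ Row a S

/-- The variable of a neuron. -/
abbrev nv (S : Spec m n) (ν : Neuron a) : Var a S := Sum.inl ν

/-- The slack variable of the form `xⱼ - xᵢ` of a ReLU relation. -/
abbrev reluSlack (S : Spec m n) (r : ReluIdx a) : Var a S := Sum.inr (Sum.inr (Sum.inl r))

/-- The coefficients of the linear forms. -/
def rowCoeff (f : DNN a) (S : Spec m n) : Row a S → Neuron a → ℝ
  | .inl e, ν => affCoeff f e ν
  | .inr (.inl r), ν => (if ν = post r then 1 else 0) - (if ν = pre r then 1 else 0)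
  | .inr (.inr (.inl k)), ν => ∑ i, if ν = inN a i then S.inMat k i else 0
  | .inr (.inr (.inr k)), ν => ∑ i, if ν = outN a i then S.outMat k i else 0

/-- The tableau in which every slack variable equals its linear form. -/
def slackTableau (f : DNN a) (S : Spec m n) : Tableau (Var a S) where
  basic := Finset.univ.filter (fun x => x.isRight)
  coeff
    | .inr ρ, .inl ν => rowCoeff f S ρ ν
    | _, _ => 0

/-- The lower bounds of all variables, from DeepPoly on the input set restricted to the
assertions `A`. -/
def lowerB (f : DNN a) (S : Spec m n) (A : Set (Assertion a)) : Var a S → ℝ :=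
  let D := deepPoly f S.lo S.hi A
  fun x => match x with
    | .inl ν => D.l ν
    | .inr (.inl e) => -affBias f e
    | .inr (.inr (.inl _)) => 0
    | .inr (.inr (.inr (.inl k))) => boxMin (rowCoeff f S (.inr (.inr (.inl k)))) D.l D.u
    | .inr (.inr (.inr (.inr k))) => boxMin (rowCoeff f S (.inr (.inr (.inr k)))) D.l D.u

/-- The upper bounds of all variables, from DeepPoly on the input set restricted to the
assertions `A`. -/
def upperB (f : DNN a) (S : Spec m n) (A : Set (Assertion a)) : Var a S → ℝ :=
  let D := deepPoly f S.lo S.hi A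
  fun x => match x with
    | .inl ν => D.u ν
    | .inr (.inl e) => -affBias f e
    | .inr (.inr (.inl r)) => max 0 (-D.l (pre r))
    | .inr (.inr (.inr (.inl k))) => S.inVec k
    | .inr (.inr (.inr (.inr k))) => S.outVec k

/-- The initial configuration. The initial basic variables are chosen by a heuristic, here
`B`. -/
def initConfig (f : DNN a) (S : Spec m n) (B : Finset (Var a S)) : State (Var a S) :=
  let t := (slackTableau f S).gauss B
  { tab := t
    R := Set.range (fun r => (nv S (pre r), nv S (post r)))
    l := lowerB f S ∅
    u := upperB f S ∅
    α := t.extend (lowerB f S ∅) }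

/-! ## Reluplex solving procedures -/

/-- One step of the local search. -/
inductive Step : State (Var a S) → State (Var a S) → Prop
  /-- Pivot a basic variable with a non-basic variable of its equation. -/
  | pivot (C : State (Var a S)) (i k : Var a S) (hi : i ∈ C.tab.basic) (hk : k ∉ C.tab.basic)
      (hik : C.tab.coeff i k ≠ 0) : Step C { C with tab := C.tab.pivot i k }
  /-- Change the assignment of the non-basic variables; the basic variables follow. -/
  | update (C : State (Var a S)) (x : Var a S → ℝ) : Step C { C with α := C.tab.extend x }
  /-- The ReLU relation `xⱼ = ReLU(xᵢ)` is definitely activated: `xⱼ - xᵢ ≤ 0`. -/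
  | active (C : State (Var a S)) (r : ReluIdx a) (h : 0 ≤ C.l (nv S (pre r))) :
      Step C { C with
        u := Function.update C.u (reluSlack S r) (min (C.u (reluSlack S r)) 0) }
  /-- The ReLU relation `xⱼ = ReLU(xᵢ)` is definitely deactivated: `0 ≤ xⱼ ≤ 0`. -/
  | inactive (C : State (Var a S)) (r : ReluIdx a) (h : C.u (nv S (pre r)) ≤ 0) :
      Step C { C with
        l := Function.update C.l (nv S (post r)) (max (C.l (nv S (post r))) 0)
        u := Function.update C.u (nv S (post r)) (min (C.u (nv S (post r))) 0) }

/-- The configuration after a split: the numerical bounds of `C` are refined by those of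
DeepPoly under the assertions `A`, which contain the new one. -/
def State.refine (f : DNN a) (A : Finset (Assertion a)) (C : State (Var a S)) :
    State (Var a S) :=
  { C with
    l := fun x => max (C.l x) (lowerB f S ↑A x)
    u := fun x => min (C.u x) (upperB f S ↑A x) }

/-- Binary trees whose nodes are labelled with sequences of configurations. The two edges
below an inner node are labelled with the assertions `x ≤ 0` (to `t`) and `x ≥ 0`
(to `t'`). -/
inductive Tree (a : Arch m n) (S : Spec m n)
  | leaf (label : List (Config (Var a S))) : Tree a S
  | node (label : List (Config (Var a S))) (x : Neuron a) (t t' : Tree a S) : Tree a S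

/-- The neuron `x` is the argument of a ReLU and is uncertain in the configuration `C`. -/
def State.Uncertain (C : State (Var a S)) (x : Neuron a) : Prop :=
  (∃ r : ReluIdx a, pre r = x) ∧ C.l (nv S x) < 0 ∧ 0 < C.u (nv S x)

/-- The sequence `cs` of configurations is a local search from `C` to `D`. -/
def LocalSearch (C D : State (Var a S)) (cs : List (State (Var a S))) : Prop :=
  cs.IsChain Step ∧ cs.head? = some C ∧ cs.getLast? = some D

/-- `Solving f A C t ans`: the tree `t` is a complete Reluplex solving from the configuration
`C` of the network `f`, with the assertions `A` made so far, and `ans` is its output. The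
search stops at the first `SAT`, and branches which it did not visit are leaves with the
empty label. -/
inductive Solving (f : DNN a) :
    Finset (Assertion a) → State (Var a S) → Tree a S → Answer → Prop
  | sat {A C D cs} (hs : LocalSearch C D cs) (hD : D.IsSat) :
      Solving f A C (.leaf (cs.map .state ++ [.sat])) .sat
  | unsat {A C D cs} (hs : LocalSearch C D cs) (hD : D.IsUnsat) :
      Solving f A C (.leaf (cs.map .state ++ [.unsat])) .unsat
  | split_unsat {A C D cs x t t'} (hs : LocalSearch C D cs) (hx : D.Uncertain x)
      (h : Solving f (insert (x, .inactive) A) (D.refine f (insert (x, .inactive) A)) t .unsat)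
      (h' : Solving f (insert (x, .active) A) (D.refine f (insert (x, .active) A)) t' .unsat) :
      Solving f A C (.node (cs.map .state) x t t') .unsat
  | split_sat_first {A C D cs x t} (hs : LocalSearch C D cs) (hx : D.Uncertain x)
      (h : Solving f (insert (x, .inactive) A) (D.refine f (insert (x, .inactive) A)) t .sat) :
      Solving f A C (.node (cs.map .state) x t (.leaf [])) .sat
  | split_sat_second {A C D cs x t t'} (hs : LocalSearch C D cs) (hx : D.Uncertain x)
      (h : Solving f (insert (x, .inactive) A) (D.refine f (insert (x, .inactive) A)) t .unsat)
      (h' : Solving f (insert (x, .active) A) (D.refine f (insert (x, .active) A)) t' .sat) :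
      Solving f A C (.node (cs.map .state) x t t') .sat
  | split_sat_first' {A C D cs x t'} (hs : LocalSearch C D cs) (hx : D.Uncertain x)
      (h' : Solving f (insert (x, .active) A) (D.refine f (insert (x, .active) A)) t' .sat) :
      Solving f A C (.node (cs.map .state) x (.leaf []) t') .sat
  | split_sat_second' {A C D cs x t t'} (hs : LocalSearch C D cs) (hx : D.Uncertain x)
      (h' : Solving f (insert (x, .active) A) (D.refine f (insert (x, .active) A)) t' .unsat)
      (h : Solving f (insert (x, .inactive) A) (D.refine f (insert (x, .inactive) A)) t .sat) :
      Solving f A C (.node (cs.map .state) x t t') .sat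

/-- The tree `𝒯` is a Reluplex solving procedure of the safety property `(f, S.X, S.P)`. -/
def IsSolvingProcedure (f : DNN a) (S : Spec m n) (𝒯 : Tree a S) : Prop :=
  ∃ (B : Finset (Var a S)) (ans : Answer), Solving f ∅ (initConfig f S B) 𝒯 ans

/-- An implementation of Reluplex for the network `f`, which resolves all heuristic choices in
some way: on every configuration from which a complete solving exists, it ends with the output
of a complete solving. -/
def IsReluplex (f : DNN a) (S : Spec m n)
    (reluplex : Finset (Assertion a) → State (Var a S) → Answer) : Prop :=
  ∀ A C, (∃ t ans, Solving f A C t ans) → ∃ t, Solving f A C t (reluplex A C)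

/-! ## The incremental algorithm -/

/-- A leaf `v` of a solving procedure: the set `Assert(v)` and the label `L(v)`. -/
structure Leaf (a : Arch m n) (S : Spec m n) where
  assert : Finset (Assertion a)
  label : List (Config (Var a S))

/-- The leaves of the tree, from left to right, below a node with the assertions `A`. -/
def Tree.leaves : Tree a S → Finset (Assertion a) → List (Leaf a S)
  | .leaf lab, A => [⟨A, lab⟩]
  | .node _ x t t', A =>
      t.leaves (insert (x, .inactive) A) ++ t'.leaves (insert (x, .active) A)

/-- The label ends with `SAT`. -/
def Leaf.IsSatLeaf (v : Leaf a S) : Prop := v.label.getLast? = some .sat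

/-- The label ends with `UNSAT`. -/
def Leaf.IsUnsatLeaf (v : Leaf a S) : Prop := v.label.getLast? = some .unsat

/-- The label is the empty sequence. -/
def Leaf.IsEmptyLeaf (v : Leaf a S) : Prop := v.label = []

/-- The last configuration of the label that is not `SAT` or `UNSAT`, and `C₀` if the label
is empty. -/
def Leaf.last (C₀ : State (Var a S)) (v : Leaf a S) : State (Var a S) :=
  ((v.label.filterMap fun c => match c with
    | .state C => some C
    | _ => none).getLast?).getD C₀

/-- The distance of two leaves. -/
def Leaf.dist (v w : Leaf a S) : ℕ := ((v.assert \ w.assert) ∪ (w.assert \ v.assert)).card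

/-- The feasible set of the linear program `LP(f ∧ X ∧ ¬P ∧ A)`: the equations of the encoding,
the numerical bounds `lowerB`, `upperB` (which contain the assertions, the input box, and the
inequalities on input and output), and the linear approximation of the ReLU relations. -/
def lpSet (f : DNN a) (S : Spec m n) (A : Finset (Assertion a)) : Set (Var a S → ℝ) :=
  {x | (slackTableau f S).Sat x ∧ (∀ y, lowerB f S ↑A y ≤ x y ∧ x y ≤ upperB f S ↑A y) ∧
    ∀ r : ReluIdx a,
      let l := lowerB f S ↑A (nv S (pre r))
      let u := upperB f S ↑A (nv S (pre r))
      let xi := x (nv S (pre r))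
      let xj := x (nv S (post r))
      if 0 ≤ l then xj = xi
      else if u ≤ 0 then xj = 0
      else 0 ≤ xj ∧ xi ≤ xj ∧ xj ≤ u * (xi - l) / (u - l)}

/-- The function `Solve(v)` for an UNSAT leaf `v`. -/
def solve (reluplex : Finset (Assertion a) → State (Var a S) → Answer) (f' : DNN a)
    (C₀ : State (Var a S)) (v : Leaf a S) : Answer :=
  let C := v.last C₀
  if lpSet f' S v.assert = ∅ then .unsat
  else
    let l := fun x => if x ∈ C.starVars
      then sInf ((fun y => y x) '' lpSet f' S v.assert) else lowerB f' S ↑v.assert x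
    let u := fun x => if x ∈ C.starVars
      then sSup ((fun y => y x) '' lpSet f' S v.assert) else upperB f' S ↑v.assert x
    let t := C₀.tab.gauss C.tab.basic
    if ∃ i, C.star = some i ∧ t.Conflict l u i then .unsat
    else reluplex v.assert { C with tab := t, l := l, u := u }

/-- The call of Reluplex for a leaf `v` labelled with SAT or with the empty sequence. -/
def solveOpen (reluplex : Finset (Assertion a) → State (Var a S) → Answer) (f' : DNN a)
    (C₀ : State (Var a S)) (v : Leaf a S) : Answer :=
  let C := v.last C₀
  reluplex v.assert
    { C with
      tab := C₀.tab.gauss C.tab.basic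
      l := lowerB f' S ↑v.assert
      u := upperB f' S ↑v.assert }

/-- Go through a list of leaves in its order and stop at the first `SAT`. -/
def firstSat (call : Leaf a S → Answer) : List (Leaf a S) → Answer
  | [] => .unsat
  | v :: vs =>
      match call v with
      | .sat => .sat
      | .unsat => firstSat call vs

/-- The incremental SMT algorithm, for the old solving procedure `𝒯` and the modified network
`f'`. The initial basic variables for `f'` are chosen by a heuristic, here `B`. A leaf remains
after the pruning iff no edge on the path to it is deleted. -/
def verify {S : Spec m n} (reluplex : Finset (Assertion a) → State (Var a S) → Answer)
    (B : Finset (Var a S)) (f' : DNN a) (𝒯 : Tree a S)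
    : Answer :=
  let U := deepPolySet f' S
  if {x ∈ U | (fun i => x (outN a i)) ∈ S.negP} = ∅ then .unsat
  else
    let C₀ := initConfig f' S B
    let pruned := (𝒯.leaves ∅).filter fun v => ∀ Q ∈ v.assert, {x ∈ U | Q.Sat x} ≠ ∅
    let openLeaves := match (𝒯.leaves ∅).find? (fun v => v.IsSatLeaf) with
      | none => []
      | some w => (pruned.filter fun v => v.IsSatLeaf ∨ v.IsEmptyLeaf).insertionSort
          fun v v' => v.dist w ≤ v'.dist w
    match firstSat (solveOpen reluplex f' C₀) openLeaves with
    | .sat => .sat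
    | .unsat => firstSat (solve reluplex f' C₀) (pruned.filter fun v => v.IsUnsatLeaf)

end

end IncSMT

/-!
The constraints of Reluplex are an exact encoding: the assignments that satisfy the equations, the
ReLU relations and the DeepPoly bounds under a set `A` of assertions are the traces of the network
that start in `X`, end in `¬P` and satisfy `A` (`encoding_iff_counterexample`). This rests on the
soundness of DeepPoly, including its back-substituted bounds (`DNN.IsTrace.deepPoly_sound`), and on
the fact that its bounds are clipped by the assertions. So the task is to decide whether there is
such a counterexample.

*Reluplex decides configurations.* A configuration that `Encodes` the network under `A` has its
equations and relations and bounds at least as tight as those of DeepPoly. Steps of the local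
search keep the solutions of such a configuration, and a split distributes them over its two
branches; hence the output of every complete search is correct (`Solving.sat_iff`). As an
implementation of Reluplex is only constrained where some complete search exists, existence is
needed as well (`State.Encodes.exists_solving`). If there is a solution, one update of the
assignment finds it. Otherwise split until no ReLU argument is uncertain, and refine the bounds so
that all ReLU relations become linear; what remains is an infeasible system of equations and
bounds, and pivots must lead to an equation that infers `UNSAT`
(`Tableau.exists_pivots_of_infeasible`). Separating the box of the bounds from the solution space
gives a linear form that vanishes on the solutions and is negative on the box. Pivoting and
eliminating entries of this form decreases the size of its support plus the number of basic
variables in it, until the form is a multiple of an equation of the tableau.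

*The algorithm asks the right questions.* The calls for a leaf `v` of the old tree return `SAT` if
and only if there is a counterexample that satisfies `Assert(v)` (`solveOpen_eq_sat_iff`,
`solve_eq_sat_iff`): the linear program relaxes the encoding, so that its minima and maxima are
bounds of every counterexample, and Gauss elimination only changes the form of the equations. The
assertions of the leaves cover all traces (`Tree.exists_leaf_sat`), a leaf that covers a
counterexample is not pruned, and every leaf that remains is visited, since a leaf that ends in
`SAT` or has the empty label occurs only in a tree with a `SAT` leaf (`Solving.leaves_labels`).
-/

namespace IncSMT

open scoped Classical

/-! ### Tableaus and pivoting -/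

section Tableaus

variable {𝒳 : Type} [Fintype 𝒳]

theorem Tableau.pivot_rhs (t : Tableau 𝒳) {i k : 𝒳} (hi : i ∈ t.basic) (hk : k ∉ t.basic)
    (p : 𝒳) (x : 𝒳 → ℝ) :
    (t.pivot i k).rhs p x = (t.pivot i k).coeff p i * x i +
      ∑ j ∈ t.basicᶜ.erase k, (t.pivot i k).coeff p j * x j := by
  have hne : i ≠ k := fun h => hk (h ▸ hi)
  have h : (t.pivot i k).basicᶜ = insert i (t.basicᶜ.erase k) := by
    ext j
    simp only [Tableau.pivot, Finset.mem_compl, Finset.mem_insert, Finset.mem_erase]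
    by_cases h1 : j = i
    · subst h1; simp [hne]
    · simp [h1]
  rw [Tableau.rhs, h, Finset.sum_insert (by simp [hi])]

theorem Tableau.rhs_eq_add_erase (t : Tableau 𝒳) {k : 𝒳} (hk : k ∉ t.basic) (p : 𝒳) (x : 𝒳 → ℝ) :
    t.rhs p x = t.coeff p k * x k + ∑ j ∈ t.basicᶜ.erase k, t.coeff p j * x j := by
  rw [Tableau.rhs, ← Finset.add_sum_erase _ _ (Finset.mem_compl.2 hk)]

/-- Pivoting does not change the solutions of the equations. -/
theorem Tableau.pivot_sat_iff (t : Tableau 𝒳) {i k : 𝒳} (hi : i ∈ t.basic) (hk : k ∉ t.basic)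
    (hik : t.coeff i k ≠ 0) (x : 𝒳 → ℝ) : (t.pivot i k).Sat x ↔ t.Sat x := by
  have hne : i ≠ k := fun h => hk (h ▸ hi)
  have hmem : ∀ j ∈ t.basicᶜ.erase k, j ≠ i := by
    rintro j hj rfl
    simp [hi] at hj
  have rowk : (t.pivot i k).rhs k x = (x i - (t.rhs i x - t.coeff i k * x k)) / t.coeff i k := by
    rw [t.pivot_rhs hi hk, t.rhs_eq_add_erase hk, add_sub_cancel_left, sub_div, Finset.sum_div,
      sub_eq_add_neg, ← Finset.sum_neg_distrib]
    congr 1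
    · simp [Tableau.pivot]; ring
    · refine Finset.sum_congr rfl fun j hj => ?_
      simp [Tableau.pivot, hmem j hj]; ring
  have rowp : ∀ p, p ≠ k → (t.pivot i k).rhs p x =
      t.rhs p x + t.coeff p k * ((t.pivot i k).rhs k x - x k) := by
    intro p hp
    rw [rowk, t.pivot_rhs hi hk, t.rhs_eq_add_erase hk p, t.rhs_eq_add_erase hk i]
    have : ∀ j ∈ t.basicᶜ.erase k, (t.pivot i k).coeff p j * x j =
        t.coeff p j * x j - t.coeff p k / t.coeff i k * (t.coeff i j * x j) := by
      intro j hj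
      simp [Tableau.pivot, hmem j hj, hp]; ring
    rw [Finset.sum_congr rfl this, Finset.sum_sub_distrib, ← Finset.mul_sum]
    simp only [Tableau.pivot, hp, if_true, if_false]
    field_simp
    ring
  have hkeq : (t.pivot i k).rhs k x = x k ↔ x i = t.rhs i x := by
    rw [rowk, div_eq_iff hik]
    constructor <;> intro h <;> linarith
  constructor
  · intro h p hp
    have h0 : (t.pivot i k).rhs k x = x k := (h k (by simp [Tableau.pivot])).symm
    by_cases hpi : p = i
    · subst hpi; exact hkeq.1 h0
    · have hpk : p ≠ k := fun e => hk (e ▸ hp)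
      have := h p (by simp [Tableau.pivot, hpi, hp])
      rw [rowp p hpk, h0] at this
      simpa using this
  · intro h p hp
    have h0 := hkeq.2 (h i hi)
    by_cases hpk : p = k
    · subst hpk; exact h0.symm
    · have hp' : p ∈ t.basic := by
        simp only [Tableau.pivot, Finset.mem_insert, Finset.mem_erase, hpk, false_or] at hp
        exact hp.2
      rw [rowp p hpk, h0, sub_self, mul_zero, add_zero]
      exact h p hp'

theorem Tableau.gauss_sat_iff (t : Tableau 𝒳) (target : Finset 𝒳) (x : 𝒳 → ℝ) :
    (t.gauss target).Sat x ↔ t.Sat x := by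
  rw [Tableau.gauss]
  generalize target.toList = vs
  induction vs generalizing t with
  | nil => rfl
  | cons v vs ih =>
    rw [List.foldl_cons, ih, Tableau.enter]
    split_ifs with h1 h2
    · rfl
    · exact t.pivot_sat_iff h2.choose_spec.1 h1 h2.choose_spec.2.2 x
    · rfl

theorem Tableau.extend_eq_self {t : Tableau 𝒳} {x : 𝒳 → ℝ} (h : t.Sat x) : t.extend x = x := by
  funext i
  rw [Tableau.extend]
  split_ifs with hi
  · exact (h i hi).symm
  · rfl

theorem Tableau.rhs_congr (t : Tableau 𝒳) (i : 𝒳) {x y : 𝒳 → ℝ}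
    (h : ∀ j, j ∉ t.basic → x j = y j) : t.rhs i x = t.rhs i y :=
  Finset.sum_congr rfl fun j hj => by rw [h j (Finset.mem_compl.1 hj)]

theorem Tableau.sat_extend (t : Tableau 𝒳) (x : 𝒳 → ℝ) : t.Sat (t.extend x) := by
  intro i hi
  rw [t.rhs_congr i (y := x) fun j hj => by simp [Tableau.extend, hj]]
  simp [Tableau.extend, hi]

/-- An equation that infers `UNSAT` has no solution within the bounds. -/
theorem Tableau.Conflict.not_sat {t : Tableau 𝒳} {l u : 𝒳 → ℝ} {i : 𝒳} (h : t.Conflict l u i)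
    {x : 𝒳 → ℝ} (hx : ∀ j, l j ≤ x j ∧ x j ≤ u j) : ¬ t.Sat x := by
  intro hs
  have he := hs i h.1
  rw [Tableau.rhs] at he
  have hmax : ∀ c : ℝ, 0 ≤ max c 0 := fun c => le_max_right _ _
  have hmin : ∀ c : ℝ, min c 0 ≤ 0 := fun c => min_le_right _ _
  have hsplit : ∀ c y : ℝ, c * y = max c 0 * y + min c 0 * y := fun c y => by
    rw [← add_mul, max_add_min, add_zero]
  rcases h.2 with h | h
  · have : ∑ j ∈ t.basicᶜ, t.coeff i j * x j ≤
        ∑ j ∈ t.basicᶜ, (max (t.coeff i j) 0 * u j + min (t.coeff i j) 0 * l j) := by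
      refine Finset.sum_le_sum fun j _ => ?_
      rw [hsplit]
      exact add_le_add (mul_le_mul_of_nonneg_left (hx j).2 (hmax _))
        (mul_le_mul_of_nonpos_left (hx j).1 (hmin _))
    linarith [(hx i).1]
  · have : ∑ j ∈ t.basicᶜ, (max (t.coeff i j) 0 * l j + min (t.coeff i j) 0 * u j) ≤
        ∑ j ∈ t.basicᶜ, t.coeff i j * x j := by
      refine Finset.sum_le_sum fun j _ => ?_
      rw [hsplit (t.coeff i j) (x j)]
      exact add_le_add (mul_le_mul_of_nonneg_left (hx j).1 (hmax _))
        (mul_le_mul_of_nonpos_left (hx j).2 (hmin _))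
    linarith [(hx i).2]

/-! ### Infeasible bounds: a sequence of pivots to a conflict -/

/-- One admissible pivot operation. -/
def Tableau.PivotStep (t t' : Tableau 𝒳) : Prop :=
  ∃ i ∈ t.basic, ∃ k, k ∉ t.basic ∧ t.coeff i k ≠ 0 ∧ t' = t.pivot i k

/-- The greatest value of `∑ⱼ vⱼ xⱼ` on the box `l ≤ x ≤ u`. -/
noncomputable def boxMax (v l u : 𝒳 → ℝ) : ℝ :=
  ∑ j, (max (v j) 0 * u j + min (v j) 0 * l j)

/-- The indices of the nonzero entries. -/
noncomputable def supp (v : 𝒳 → ℝ) : Finset 𝒳 := Finset.univ.filter fun j => v j ≠ 0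

@[simp] theorem mem_supp {v : 𝒳 → ℝ} {j : 𝒳} : j ∈ supp v ↔ v j ≠ 0 := by simp [supp]

/-- Farkas' lemma for a tableau with bounds: if no solution of the equations is within the
bounds, then a linear form that vanishes on all solutions is negative on the whole box. -/
theorem Tableau.exists_certificate (t : Tableau 𝒳) {l u : 𝒳 → ℝ} (hlu : ∀ x, l x ≤ u x)
    (h : ∀ x, t.Sat x → ¬ ∀ j, l j ≤ x j ∧ x j ≤ u j) :
    ∃ v : 𝒳 → ℝ, (∀ x, t.Sat x → ∑ j, v j * x j = 0) ∧ boxMax v l u < 0 := by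
  have hconv : Convex ℝ {x | t.Sat x} := by
    intro x hx y hy a b _ _ _ i hi
    simp only [Pi.add_apply, Pi.smul_apply, smul_eq_mul]
    rw [hx i hi, hy i hi, Tableau.rhs, Tableau.rhs, Tableau.rhs, Finset.mul_sum,
      Finset.mul_sum, ← Finset.sum_add_distrib]
    exact Finset.sum_congr rfl fun j _ => by
      simp only [Pi.add_apply, Pi.smul_apply, smul_eq_mul]; ring
  have hclosed : IsClosed {x | t.Sat x} := by
    simp only [Tableau.Sat, Tableau.rhs, Set.ofPred_forall]
    refine isClosed_iInter fun i => isClosed_iInter fun _ => isClosed_eq ?_ ?_ <;> fun_prop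
  have hdisj : Disjoint (Set.Icc l u) {x | t.Sat x} := by
    rw [Set.disjoint_left]
    exact fun x hx hs => h x hs fun j => ⟨hx.1 j, hx.2 j⟩
  obtain ⟨φ, r, s, hr, hrs, hs⟩ :=
    geometric_hahn_banach_compact_closed (convex_Icc l u) isCompact_Icc hconv hclosed hdisj
  have h0 : s < 0 := by
    have : t.Sat 0 := fun i _ => by simp [Tableau.rhs]
    simpa using hs 0 this
  have hφ : ∀ x, φ x = ∑ j, φ (Pi.single j 1) * x j := by
    intro x
    conv_lhs => rw [← Finset.univ_sum_single x, map_sum]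
    refine Finset.sum_congr rfl fun j _ => ?_
    have : Pi.single j (x j) = x j • (Pi.single j 1 : 𝒳 → ℝ) := by
      rw [← Pi.single_smul]; simp
    rw [this, map_smul, smul_eq_mul, mul_comm]
  refine ⟨fun j => φ (Pi.single j 1), fun x hx => ?_, ?_⟩
  · rw [← hφ]
    -- a nonzero value on a solution could be scaled to the separating constant
    by_contra hne
    have hsat : t.Sat ((s / φ x) • x) := by
      intro i hi
      simp only [Tableau.rhs, Pi.smul_apply, smul_eq_mul]
      rw [hx i hi, Tableau.rhs, Finset.mul_sum]
      exact Finset.sum_congr rfl fun j _ => by ring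
    have := hs _ hsat
    rw [map_smul, smul_eq_mul, div_mul_cancel₀ _ hne] at this
    exact lt_irrefl _ this
  · have hc := hr (fun j => if 0 ≤ φ (Pi.single j 1) then u j else l j)
      ⟨fun j => by dsimp only; split_ifs; exacts [hlu j, le_rfl],
        fun j => by dsimp only; split_ifs; exacts [le_rfl, hlu j]⟩
    rw [hφ] at hc
    have : boxMax (fun j => φ (Pi.single j 1)) l u =
        ∑ j, φ (Pi.single j 1) * (if 0 ≤ φ (Pi.single j 1) then u j else l j) := by
      refine Finset.sum_congr rfl fun j _ => ?_
      split_ifs with hj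
      · simp [hj]
      · simp [(not_le.1 hj).le]
    linarith

/-- Of a vector `v` that is negative on a box and a nonzero vector `w` of smaller support, some
linear combination is negative on the box and has smaller support than `v`. -/
theorem exists_smaller_supp {v w l u : 𝒳 → ℝ} (hv : boxMax v l u < 0) (hw : w ≠ 0)
    (hwv : supp w ⊂ supp v) :
    ∃ α β : ℝ, boxMax (fun j => α * v j + β * w j) l u < 0 ∧
      supp (fun j => α * v j + β * w j) ⊂ supp v := by
  -- `∑ⱼ cⱼ zⱼ` is the maximum of `z` on the box as long as the support of `z` is within that of `v`
  -- and no sign of `z` is opposite to that of `v`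
  set c : 𝒳 → ℝ := fun j => if 0 ≤ v j then u j else l j with hc
  have hlin : ∀ z : 𝒳 → ℝ, (∀ j, 0 ≤ v j * z j) → (∀ j, v j = 0 → z j = 0) →
      boxMax z l u = ∑ j, z j * c j := by
    intro z hz hz0
    refine Finset.sum_congr rfl fun j _ => ?_
    simp only [hc]
    split_ifs with hj
    · rcases hj.eq_or_lt with hj | hj
      · simp [hz0 j hj.symm]
      · have : 0 ≤ z j := nonneg_of_mul_nonneg_right (hz j) hj
        simp [this]
    · have : z j ≤ 0 := by
        by_contra h
        exact absurd (hz j) (not_le.2 (mul_neg_of_neg_of_pos (not_le.1 hj) (not_le.1 h)))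
      simp [this]
  have hw0 : ∀ j, v j = 0 → w j = 0 := fun j hj => by
    by_contra h
    exact (mem_supp.1 (hwv.1 (mem_supp.2 h))) hj
  have hV : ∑ j, v j * c j < 0 := by
    rw [← hlin v (fun j => mul_self_nonneg _) fun _ h => h]; exact hv
  obtain ⟨i, hi⟩ : ∃ i, w i ≠ 0 := by
    by_contra h; push Not at h; exact hw (funext h)
  have hvi : v i ≠ 0 := fun h => hi (hw0 i h)
  -- orient `w` such that the form does not increase in the direction `-w`
  obtain ⟨σ, hσ, hG, hdir⟩ : ∃ σ : ℝ, σ ≠ 0 ∧ 0 ≤ ∑ j, (σ * w j) * c j ∧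
      (0 < ∑ j, (σ * w j) * c j ∨ ∃ j, 0 < v j * (σ * w j)) := by
    have key : ∀ σ : ℝ, ∑ j, (σ * w j) * c j = σ * ∑ j, w j * c j := fun σ => by
      rw [Finset.mul_sum]; exact Finset.sum_congr rfl fun j _ => by ring
    simp only [key]
    rcases lt_trichotomy (∑ j, w j * c j) 0 with h | h | h
    · exact ⟨-1, by norm_num, by linarith, Or.inl (by linarith)⟩
    · refine ⟨v i * w i, mul_ne_zero hvi hi, by simp [h], Or.inr ⟨i, ?_⟩⟩
      have : 0 < (v i * w i) ^ 2 := by positivity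
      nlinarith
    · exact ⟨1, by norm_num, by linarith, Or.inl (by linarith)⟩
  by_cases hpos : ∃ j, 0 < v j * (σ * w j)
  · -- move from `v` in the direction `-w` up to the first new zero entry
    obtain ⟨j₀, hj₀, hmin⟩ := Finset.exists_min_image
      (Finset.univ.filter fun j => 0 < v j * (σ * w j)) (fun j => v j / (σ * w j))
      (by obtain ⟨j, hj⟩ := hpos; exact ⟨j, by simpa using hj⟩)
    simp only [Finset.mem_filter, Finset.mem_univ, true_and] at hj₀ hmin
    set τ := v j₀ / (σ * w j₀) with hτ
    have hwj₀ : σ * w j₀ ≠ 0 := fun h => by simp [h] at hj₀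
    have hvj₀ : v j₀ ≠ 0 := fun h => by simp [h] at hj₀
    have hτ0 : 0 ≤ τ := by
      have : τ = v j₀ * (σ * w j₀) / (σ * w j₀) ^ 2 := by rw [hτ]; field_simp
      rw [this]; positivity
    have hsign : ∀ j, 0 ≤ v j * (1 * v j + (-τ * σ) * w j) := by
      intro j
      have hexp : v j * (1 * v j + (-τ * σ) * w j) = v j * v j - τ * (v j * (σ * w j)) := by ring
      rw [hexp]
      by_cases hj : 0 < v j * (σ * w j)
      · have h1 : τ ≤ v j / (σ * w j) := hmin j hj
        have h2 : σ * w j ≠ 0 := fun h => by simp [h] at hj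
        have h3 := mul_le_mul_of_nonneg_right h1 hj.le
        have h4 : v j / (σ * w j) * (v j * (σ * w j)) = v j * v j := by
          rw [mul_left_comm, div_mul_cancel₀ _ h2]
        linarith
      · have := mul_nonneg hτ0 (neg_nonneg.2 (not_lt.1 hj))
        nlinarith [mul_self_nonneg (v j)]
    have hzero : ∀ j, v j = 0 → 1 * v j + (-τ * σ) * w j = 0 := fun j hj => by
      simp [hj, hw0 j hj]
    refine ⟨1, -τ * σ, ?_, Finset.ssubset_iff_subset_ne.2 ⟨fun j hj => ?_, fun h => ?_⟩⟩
    · rw [hlin _ hsign hzero]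
      have : ∑ j, (1 * v j + (-τ * σ) * w j) * c j =
          ∑ j, v j * c j - τ * ∑ j, (σ * w j) * c j := by
        rw [Finset.mul_sum, ← Finset.sum_sub_distrib]
        exact Finset.sum_congr rfl fun j _ => by ring
      rw [this]
      have := mul_nonneg hτ0 hG
      linarith
    · exact mem_supp.2 fun h => mem_supp.1 hj (hzero j h)
    · have : j₀ ∈ supp v := mem_supp.2 hvj₀
      rw [← h, mem_supp] at this
      refine this ?_
      have : τ * (σ * w j₀) = v j₀ := by rw [hτ, div_mul_cancel₀ _ hwj₀]
      linarith
  · -- no sign of `-w` is opposite to that of `v`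
    have hG' := hdir.resolve_right hpos
    push Not at hpos
    have hsupp : supp (fun j => 0 * v j + -σ * w j) = supp w := by
      ext j; simp [hσ]
    refine ⟨0, -σ, ?_, hsupp ▸ hwv⟩
    rw [hlin _ (fun j => by nlinarith [hpos j]) fun j hj => by simp [hw0 j hj]]
    have : ∑ j, (0 * v j + -σ * w j) * c j = - ∑ j, (σ * w j) * c j := by
      rw [← Finset.sum_neg_distrib]; exact Finset.sum_congr rfl fun j _ => by ring
    linarith

/-- A linear form that vanishes on the solutions of a tableau is determined by its basic
coefficients. -/
theorem Tableau.eq_of_vanishing {t : Tableau 𝒳} {v : 𝒳 → ℝ}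
    (hv : ∀ x, t.Sat x → ∑ j, v j * x j = 0) {k : 𝒳} (hk : k ∉ t.basic) :
    v k = -∑ i ∈ t.basic, v i * t.coeff i k := by
  have h := hv _ (t.sat_extend (Pi.single k 1))
  have hB : ∀ i ∈ t.basic, v i * t.extend (Pi.single k 1) i = v i * t.coeff i k := by
    intro i hi
    simp [Tableau.extend, hi, Tableau.rhs, Pi.single_apply, hk]
  have hN : ∀ j ∈ t.basicᶜ, v j * t.extend (Pi.single k 1) j = if j = k then v k else 0 := by
    intro j hj
    rw [Finset.mem_compl] at hj
    simp only [Tableau.extend, hj, if_false, Pi.single_apply]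
    split_ifs with h
    · rw [h, mul_one]
    · simp
  rw [← Finset.sum_add_sum_compl t.basic, Finset.sum_congr rfl hB, Finset.sum_congr rfl hN] at h
  simp [hk] at h
  linarith

/-- The linear form `xᵢ - ∑ⱼ aᵢⱼ xⱼ` of an equation of the tableau. -/
noncomputable def Tableau.rowForm (t : Tableau 𝒳) (i : 𝒳) : 𝒳 → ℝ :=
  fun j => if j = i then 1 else if j ∈ t.basic then 0 else -t.coeff i j

theorem Tableau.sum_rowForm {t : Tableau 𝒳} {i : 𝒳} (hi : i ∈ t.basic) (x : 𝒳 → ℝ) :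
    ∑ j, t.rowForm i j * x j = x i - t.rhs i x := by
  have hB : ∀ j ∈ t.basic, t.rowForm i j * x j = if j = i then x i else 0 := by
    intro j hj
    simp only [Tableau.rowForm, hj, if_true]
    split_ifs with h
    · rw [h, one_mul]
    · simp
  have hN : ∀ j ∈ t.basicᶜ, t.rowForm i j * x j = -(t.coeff i j * x j) := by
    intro j hj
    rw [Finset.mem_compl] at hj
    have : j ≠ i := fun h => hj (h ▸ hi)
    simp [Tableau.rowForm, hj, this]
  rw [← Finset.sum_add_sum_compl t.basic, Finset.sum_congr rfl hB, Finset.sum_congr rfl hN]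
  simp [hi, Tableau.rhs, sub_eq_add_neg]

/-- If a multiple of an equation is negative on the box, then this equation infers `UNSAT`. -/
theorem Tableau.conflict_of_boxMax {t : Tableau 𝒳} {l u v : 𝒳 → ℝ} {i : 𝒳} (hi : i ∈ t.basic)
    (hv0 : v i ≠ 0) (hB : ∀ j ∈ t.basic, j ≠ i → v j = 0)
    (hN : ∀ j, j ∉ t.basic → v j = -(v i * t.coeff i j)) (h : boxMax v l u < 0) :
    t.Conflict l u i := by
  have hsum : boxMax v l u = (max (v i) 0 * u i + min (v i) 0 * l i) +
      ∑ j ∈ t.basicᶜ, (max (v j) 0 * u j + min (v j) 0 * l j) := by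
    rw [boxMax, ← Finset.sum_add_sum_compl t.basic]
    congr 1
    refine Finset.sum_eq_single_of_mem i hi fun j hj hji => ?_
    simp [hB j hj hji]
  rw [hsum] at h
  refine ⟨hi, ?_⟩
  rcases lt_or_gt_of_ne hv0 with hneg | hpos
  · left
    have : ∑ j ∈ t.basicᶜ, (max (v j) 0 * u j + min (v j) 0 * l j) =
        -v i * ∑ j ∈ t.basicᶜ, (max (t.coeff i j) 0 * u j + min (t.coeff i j) 0 * l j) := by
      rw [Finset.mul_sum]
      refine Finset.sum_congr rfl fun j hj => ?_
      rw [hN j (Finset.mem_compl.1 hj)]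
      rcases le_total 0 (t.coeff i j) with hc | hc
      · have : 0 ≤ -(v i * t.coeff i j) := by nlinarith
        rw [max_eq_left this, min_eq_right this, max_eq_left hc, min_eq_right hc]; ring
      · have : -(v i * t.coeff i j) ≤ 0 := by nlinarith
        rw [max_eq_right this, min_eq_left this, max_eq_right hc, min_eq_left hc]; ring
    rw [this, max_eq_right hneg.le, min_eq_left hneg.le] at h
    by_contra hcon
    push Not at hcon
    nlinarith
  · right
    have : ∑ j ∈ t.basicᶜ, (max (v j) 0 * u j + min (v j) 0 * l j) =
        -v i * ∑ j ∈ t.basicᶜ, (max (t.coeff i j) 0 * l j + min (t.coeff i j) 0 * u j) := by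
      rw [Finset.mul_sum]
      refine Finset.sum_congr rfl fun j hj => ?_
      rw [hN j (Finset.mem_compl.1 hj)]
      rcases le_total 0 (t.coeff i j) with hc | hc
      · have : -(v i * t.coeff i j) ≤ 0 := by nlinarith
        rw [max_eq_right this, min_eq_left this, max_eq_left hc, min_eq_right hc]; ring
      · have : 0 ≤ -(v i * t.coeff i j) := by nlinarith
        rw [max_eq_left this, min_eq_right this, max_eq_right hc, min_eq_left hc]; ring
    rw [this, max_eq_left hpos.le, min_eq_right hpos.le] at h
    by_contra hcon
    push Not at hcon
    nlinarith

/-- From a certificate of infeasibility, pivots lead to an equation that infers `UNSAT`. A pivot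
on a basic variable of the certificate and a non-basic variable outside of it removes a basic
variable from the certificate; where there is no such pivot, either the certificate is a multiple
of an equation or some equation can be used to shrink its support. -/
theorem Tableau.exists_pivots_of_certificate {l u : 𝒳 → ℝ} (N : ℕ) :
    ∀ (t : Tableau 𝒳) (v : 𝒳 → ℝ), (supp v).card + (supp v ∩ t.basic).card = N →
      (∀ x, t.Sat x → ∑ j, v j * x j = 0) → boxMax v l u < 0 →
      ∃ t', Relation.ReflTransGen Tableau.PivotStep t t' ∧ ∃ i, t'.Conflict l u i := by
  induction N using Nat.strong_induction_on with
  | _ N ih =>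
  intro t v hN hv hneg
  by_cases hp : ∃ i ∈ t.basic, v i ≠ 0 ∧ ∃ k, k ∉ t.basic ∧ v k = 0 ∧ t.coeff i k ≠ 0
  · obtain ⟨i, hi, hvi, k, hk, hvk, hik⟩ := hp
    have hlt : (supp v ∩ (t.pivot i k).basic).card < (supp v ∩ t.basic).card := by
      refine Finset.card_lt_card (Finset.ssubset_iff_subset_ne.2 ⟨fun j hj => ?_, fun h => ?_⟩)
      · simp only [Tableau.pivot, Finset.mem_inter, mem_supp, Finset.mem_insert,
          Finset.mem_erase] at hj ⊢
        refine ⟨hj.1, ?_⟩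
        rcases hj.2 with rfl | h
        · exact absurd hvk hj.1
        · exact h.2
      · have : i ∈ supp v ∩ t.basic := by simp [hvi, hi]
        rw [← h] at this
        have hne : i ≠ k := fun h => hk (h ▸ hi)
        simp [Tableau.pivot, hne] at this
    obtain ⟨t', ht', hc⟩ := ih _ (by omega) (t.pivot i k) v rfl
      (fun x hx => hv x ((t.pivot_sat_iff hi hk hik x).1 hx)) hneg
    exact ⟨t', .head ⟨i, hi, k, hk, hik, rfl⟩ ht', hc⟩
  · push Not at hp
    obtain ⟨i, hi, hvi⟩ : ∃ i ∈ t.basic, v i ≠ 0 := by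
      by_contra h
      push Not at h
      have : v = 0 := by
        funext j
        by_cases hj : j ∈ t.basic
        · exact h j hj
        · rw [t.eq_of_vanishing hv hj, Finset.sum_eq_zero fun i hi => by rw [h i hi, zero_mul]]
          simp
      simp [this, boxMax] at hneg
    by_cases hex : ∃ i' ∈ t.basic, i' ≠ i ∧ v i' ≠ 0
    · obtain ⟨i', hi', hne, hvi'⟩ := hex
      have hsub : supp (t.rowForm i) ⊂ supp v := by
        refine Finset.ssubset_iff_subset_ne.2 ⟨fun j hj => ?_, fun h => ?_⟩
        · rw [mem_supp] at hj ⊢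
          rw [Tableau.rowForm] at hj
          split_ifs at hj with h1 h2
          · rwa [h1]
          · simp at hj
          · exact fun h0 => hj (by rw [hp i hi hvi j h2 h0, neg_zero])
        · have : i' ∈ supp v := mem_supp.2 hvi'
          rw [← h, mem_supp, Tableau.rowForm] at this
          simp [hne, hi'] at this
      have hw : t.rowForm i ≠ 0 := fun h => by
        have := congrFun h i
        simp [Tableau.rowForm] at this
      obtain ⟨α, β, hz, hzs⟩ := exists_smaller_supp hneg hw hsub
      refine ih _ ?_ t _ rfl (fun x hx => ?_) hz
      · have h1 := Finset.card_lt_card hzs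
        have h2 := Finset.card_le_card (Finset.inter_subset_inter_right (u := t.basic) hzs.1)
        omega
      · have : ∑ j, (α * v j + β * t.rowForm i j) * x j =
            α * ∑ j, v j * x j + β * ∑ j, t.rowForm i j * x j := by
          rw [Finset.mul_sum, Finset.mul_sum, ← Finset.sum_add_distrib]
          exact Finset.sum_congr rfl fun j _ => by ring
        rw [this, hv x hx, t.sum_rowForm hi, hx i hi]
        simp
    · push Not at hex
      refine ⟨t, .refl, i, t.conflict_of_boxMax hi hvi hex (fun j hj => ?_) hneg⟩
      rw [t.eq_of_vanishing hv hj, Finset.sum_eq_single_of_mem i hi fun k hk hki => by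
        rw [hex k hk hki, zero_mul]]

theorem Tableau.exists_pivots_of_infeasible (t : Tableau 𝒳) {l u : 𝒳 → ℝ} (hlu : ∀ x, l x ≤ u x)
    (h : ∀ x, t.Sat x → ¬ ∀ j, l j ≤ x j ∧ x j ≤ u j) :
    ∃ t', Relation.ReflTransGen Tableau.PivotStep t t' ∧ ∃ i, t'.Conflict l u i := by
  obtain ⟨v, hv, hneg⟩ := t.exists_certificate hlu h
  exact Tableau.exists_pivots_of_certificate _ t v rfl hv hneg

end Tableaus

/-! ### The values of the neurons of a network -/

section Traces

variable {m n : ℕ}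

theorem sum_neuron_affine {k n : ℕ} (g : Arch m k) (F : Neuron (Arch.affine g n) → ℝ) :
    ∑ ν, F ν = ∑ ν : Neuron g, F (Sum.inl ν) + ∑ i : Fin n, F (Sum.inr i) :=
  Fintype.sum_sum_type F

theorem sum_neuron_relu {k : ℕ} (g : Arch m k) (F : Neuron (Arch.relu g) → ℝ) :
    ∑ ν, F ν = ∑ ν : Neuron g, F (Sum.inl ν) + ∑ i : Fin k, F (Sum.inr i) :=
  Fintype.sum_sum_type F

theorem sum_ite_mul {ι κ : Type} [Fintype ι] [Fintype κ] (φ : κ → ι) (M : κ → ℝ) (y : ι → ℝ) :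
    ∑ ν, (∑ i, if ν = φ i then M i else 0) * y ν = ∑ i, M i * y (φ i) := by
  simp_rw [Finset.sum_mul]
  rw [Finset.sum_comm]
  refine Finset.sum_congr rfl fun i _ => ?_
  simp

/-- `y` assigns to all neurons values that satisfy the affine equations and the ReLU relations
of the network. -/
def DNN.IsTrace {a : Arch m n} (f : DNN a) (y : Neuron a → ℝ) : Prop :=
  (∀ e, ∑ ν, affCoeff f e ν * y ν = -affBias f e) ∧
    ∀ r : ReluIdx a, y (post r) = max 0 (y (pre r))

theorem DNN.isTrace_input (y : Fin m → ℝ) : (DNN.input : DNN (Arch.input (m := m))).IsTrace y :=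
  ⟨fun e => Empty.elim e, fun r => Empty.elim r⟩

theorem DNN.isTrace_affine {k : ℕ} {g : Arch m k} (f : DNN g) (W : Matrix (Fin n) (Fin k) ℝ)
    (b : Fin n → ℝ) (y : Neuron (Arch.affine g n) → ℝ) :
    (DNN.affine f W b).IsTrace y ↔ f.IsTrace (fun ν => y (Sum.inl ν)) ∧
      ∀ i : Fin n, y (Sum.inr i) = ∑ j, W i j * y (Sum.inl (outN g j)) + b i := by
  have hold : ∀ e : AffIdx g, ∑ ν, affCoeff (DNN.affine f W b) (Sum.inl e) ν * y ν =
      ∑ ν, affCoeff f e ν * y (Sum.inl ν) := by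
    intro e
    refine (sum_neuron_affine g _).trans ?_
    change ∑ ν : Neuron g, affCoeff f e ν * y (Sum.inl ν) + ∑ i : Fin n, (0 : ℝ) * y (Sum.inr i) = _
    simp
  have hnew : ∀ i : Fin n, ∑ ν, affCoeff (DNN.affine f W b) (Sum.inr i) ν * y ν =
      ∑ j, W i j * y (Sum.inl (outN g j)) - y (Sum.inr i) := by
    intro i
    refine (sum_neuron_affine g _).trans ?_
    change ∑ ν : Neuron g, (∑ j, if ν = outN g j then W i j else 0) * y (Sum.inl ν) +
      ∑ i' : Fin n, (if i' = i then (-1 : ℝ) else 0) * y (Sum.inr i') = _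
    rw [sum_ite_mul (outN g) (W i) (fun ν => y (Sum.inl ν))]
    simp [sub_eq_add_neg]
  constructor
  · rintro ⟨h1, h2⟩
    refine ⟨⟨fun e => ?_, fun r => h2 r⟩, fun i => ?_⟩
    · rw [← hold]; exact h1 (Sum.inl e)
    · have := h1 (Sum.inr i)
      rw [hnew] at this
      simp only [affBias, Sum.elim_inr] at this
      linarith
  · rintro ⟨⟨h1, h2⟩, h3⟩
    refine ⟨?_, fun r => h2 r⟩
    rintro (e | i)
    · rw [hold]; exact h1 e
    · rw [hnew, h3 i]
      simp [affBias]

theorem DNN.isTrace_relu {k : ℕ} {g : Arch m k} (f : DNN g) (y : Neuron (Arch.relu g) → ℝ) :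
    (DNN.relu f).IsTrace y ↔ f.IsTrace (fun ν => y (Sum.inl ν)) ∧
      ∀ i : Fin k, y (Sum.inr i) = max 0 (y (Sum.inl (outN g i))) := by
  have hold : ∀ e : AffIdx g, ∑ ν, affCoeff (DNN.relu f) e ν * y ν =
      ∑ ν, affCoeff f e ν * y (Sum.inl ν) := by
    intro e
    refine (sum_neuron_relu g _).trans ?_
    change ∑ ν : Neuron g, affCoeff f e ν * y (Sum.inl ν) + ∑ i : Fin k, (0 : ℝ) * y (Sum.inr i) = _
    simp
  constructor
  · rintro ⟨h1, h2⟩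
    refine ⟨⟨fun e => ?_, fun r => h2 (Sum.inl r)⟩, fun i => h2 (Sum.inr i)⟩
    rw [← hold]; exact h1 e
  · rintro ⟨⟨h1, h2⟩, h3⟩
    refine ⟨fun e => ?_, ?_⟩
    · exact (hold e).trans (h1 e)
    · rintro (r | i)
      · exact h2 r
      · exact h3 i

/-- The output neurons of a trace carry the value of the network on its input neurons. -/
theorem DNN.IsTrace.eval_eq {a : Arch m n} {f : DNN a} {y : Neuron a → ℝ} (h : f.IsTrace y) :
    f.eval (fun i => y (inN a i)) = fun i => y (outN a i) := by
  induction f with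
  | input => rfl
  | affine f W b ih =>
    rw [DNN.isTrace_affine] at h
    funext i
    have := ih h.1
    refine Eq.trans ?_ (h.2 i).symm
    exact congrArg (· + b i)
      (Finset.sum_congr rfl fun j _ => congrArg (W i j * ·) (congrFun this j))
  | relu f ih =>
    rw [DNN.isTrace_relu] at h
    funext i
    exact (congrArg (max 0) (congrFun (ih h.1) i)).trans (h.2 i).symm

theorem DNN.exists_isTrace {a : Arch m n} (f : DNN a) (x : Fin m → ℝ) :
    ∃ y, f.IsTrace y ∧ ∀ i, y (inN a i) = x i := by
  induction f with
  | input => exact ⟨x, DNN.isTrace_input x, fun _ => rfl⟩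
  | affine f W b ih =>
    obtain ⟨y, hy, hx⟩ := ih
    refine ⟨Sum.elim y fun i => ∑ j, W i j * y (outN _ j) + b i, ?_, fun i => hx i⟩
    exact (DNN.isTrace_affine f W b _).2 ⟨hy, fun _ => rfl⟩
  | relu f ih =>
    obtain ⟨y, hy, hx⟩ := ih
    refine ⟨Sum.elim y fun i => max 0 (y (outN _ i)), ?_, fun i => hx i⟩
    exact (DNN.isTrace_relu f _).2 ⟨hy, fun _ => rfl⟩

/-! ### Soundness of DeepPoly -/

theorem boxMin_le {ι : Type} [Fintype ι] {c l u x : ι → ℝ} (h : ∀ j, l j ≤ x j ∧ x j ≤ u j) :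
    boxMin c l u ≤ ∑ j, c j * x j := by
  refine Finset.sum_le_sum fun j _ => ?_
  calc max (c j) 0 * l j + min (c j) 0 * u j
      ≤ max (c j) 0 * x j + min (c j) 0 * x j :=
        add_le_add (mul_le_mul_of_nonneg_left (h j).1 (le_max_right _ _))
          (mul_le_mul_of_nonpos_left (h j).2 (min_le_right _ _))
    _ = c j * x j := by rw [← add_mul, max_add_min, add_zero]

theorem clipL_le {N : Type} {A : Set (N × Phase)} {ν : N} {l x : ℝ} (hl : l ≤ x)
    (hA : (ν, Phase.active) ∈ A → 0 ≤ x) : clipL A ν l ≤ x := by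
  rw [clipL]
  split_ifs with h
  exacts [max_le hl (hA h), hl]

theorem le_clipU {N : Type} {A : Set (N × Phase)} {ν : N} {u x : ℝ} (hu : x ≤ u)
    (hA : (ν, Phase.inactive) ∈ A → x ≤ 0) : x ≤ clipU A ν u := by
  rw [clipU]
  split_ifs with h
  exacts [le_min hu (hA h), hu]

theorem le_clipL {N : Type} (A : Set (N × Phase)) (ν : N) (l : ℝ) : l ≤ clipL A ν l := by
  rw [clipL]
  split_ifs
  exacts [le_max_left _ _, le_rfl]

theorem clipU_le {N : Type} (A : Set (N × Phase)) (ν : N) (u : ℝ) : clipU A ν u ≤ u := by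
  rw [clipU]
  split_ifs
  exacts [min_le_left _ _, le_rfl]

theorem clipL_nonneg {N : Type} {A : Set (N × Phase)} {ν : N} (h : (ν, Phase.active) ∈ A) (l : ℝ) :
    0 ≤ clipL A ν l := by
  rw [clipL, if_pos h]; exact le_max_right _ _

theorem clipU_nonpos {N : Type} {A : Set (N × Phase)} {ν : N} (h : (ν, Phase.inactive) ∈ A)
    (u : ℝ) : clipU A ν u ≤ 0 := by
  rw [clipU, if_pos h]; exact min_le_right _ _

theorem lowSlope_nonneg (l u : ℝ) : 0 ≤ lowSlope l u := by
  rw [lowSlope]; split_ifs <;> norm_num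

theorem lowSlope_mul_le (l u x : ℝ) : lowSlope l u * x ≤ max 0 x := by
  rw [lowSlope]
  split_ifs with h1 <;> simp

theorem le_upSlope_mul_add {l u x : ℝ} (hl : l ≤ x) (hu : x ≤ u) :
    max 0 x ≤ upSlope l u * x + upConst l u := by
  rw [upSlope, upConst]
  split_ifs with h1 h2
  · simp [h1.trans hl]
  · simp [hu.trans h2]
  · push Not at h1 h2
    have h : 0 < u - l := by linarith
    rw [div_mul_eq_mul_div, ← add_div, le_div_iff₀ h]
    rcases le_total 0 x with hx | hx
    · rw [max_eq_right hx]; nlinarith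
    · rw [max_eq_left hx]; nlinarith

/-- The bounds of DeepPoly, and the lower bounds that it computes by back-substitution, hold for
all traces within the input box that satisfy the assertions. -/
theorem DNN.IsTrace.deepPoly_sound {a : Arch m n} {f : DNN a} {y : Neuron a → ℝ}
    (h : f.IsTrace y) {lo hi : Fin m → ℝ} (hbox : ∀ i, lo i ≤ y (inN a i) ∧ y (inN a i) ≤ hi i)
    {A : Set (Neuron a × Phase)} (hA : ∀ Q ∈ A, Assertion.Sat Q y) :
    (∀ c d, (deepPoly f lo hi A).lower c d ≤ ∑ i, c i * y (outN a i) + d) ∧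
      ∀ ν, (deepPoly f lo hi A).l ν ≤ y ν ∧ y ν ≤ (deepPoly f lo hi A).u ν := by
  induction f with
  | input =>
    have hb : ∀ i, clipL A i (lo i) ≤ y i ∧ y i ≤ clipU A i (hi i) := fun i =>
      ⟨clipL_le (hbox i).1 fun hi => hA _ hi, le_clipU (hbox i).2 fun hi => hA _ hi⟩
    exact ⟨fun c d => add_le_add_left (boxMin_le hb) d, hb⟩
  | @affine k n g f W b ih =>
    rw [DNN.isTrace_affine] at h
    obtain ⟨ihlow, ihb⟩ := ih h.1 hbox (A := {p | (Sum.inl p.1, p.2) ∈ A}) (by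
      rintro ⟨ν, _ | _⟩ hp <;> exact hA _ hp)
    have hlow : ∀ (c : Fin n → ℝ) d, (deepPoly (DNN.affine f W b) lo hi A).lower c d ≤
        ∑ i, c i * y (Sum.inr i) + d := by
      intro c d
      refine (ihlow _ _).trans (le_of_eq ?_)
      simp_rw [h.2, mul_add, Finset.sum_add_distrib, Finset.sum_mul, Finset.mul_sum]
      rw [Finset.sum_comm]
      simp_rw [mul_assoc]
      ring
    refine ⟨hlow, ?_⟩
    rintro (ν | i)
    · exact ihb ν
    · have h1 := hlow (Pi.single i 1) 0
      have h2 := hlow (Pi.single i (-1)) 0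
      simp only [Pi.single_apply, ite_mul, zero_mul, Finset.sum_ite_eq', Finset.mem_univ, if_true,
        one_mul, add_zero, neg_one_mul] at h1 h2
      exact ⟨clipL_le h1 fun hi => hA _ hi, le_clipU (le_neg_of_le_neg h2) fun hi => hA _ hi⟩
  | @relu k g f ih =>
    rw [DNN.isTrace_relu] at h
    obtain ⟨ihlow, ihb⟩ := ih h.1 hbox (A := {p | (Sum.inl p.1, p.2) ∈ A}) (by
      rintro ⟨ν, _ | _⟩ hp <;> exact hA _ hp)
    refine ⟨fun c d => ?_, ?_⟩
    · refine (ihlow _ _).trans ?_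
      rw [add_comm d, ← add_assoc, ← Finset.sum_add_distrib]
      refine add_le_add_left (Finset.sum_le_sum fun i _ => ?_) d
      obtain ⟨hl, hu⟩ := ihb (outN g i)
      rw [show (outN (Arch.relu g) i) = Sum.inr i from rfl, h.2 i]
      split_ifs with hc
      · rw [add_zero, mul_assoc]
        exact mul_le_mul_of_nonneg_left (lowSlope_mul_le _ _ _) hc
      · rw [mul_assoc, ← mul_add]
        exact mul_le_mul_of_nonpos_left (le_upSlope_mul_add hl hu) (not_le.1 hc).le
    · rintro (ν | i)
      · exact ihb ν
      · obtain ⟨hl, hu⟩ := ihb (outN g i)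
        refine ⟨clipL_le ?_ fun hi => hA _ hi, le_clipU ?_ fun hi => hA _ hi⟩
        · rw [h.2 i]
          exact (mul_le_mul_of_nonneg_left hl (lowSlope_nonneg _ _)).trans (lowSlope_mul_le _ _ _)
        · rw [h.2 i]
          split_ifs with h0
          · exact max_le le_rfl (hu.trans h0)
          · exact max_le (not_le.1 h0).le hu

/-- The DeepPoly bounds are within the input box. -/
theorem deepPoly_box {a : Arch m n} (f : DNN a) (lo hi : Fin m → ℝ) (A : Set (Neuron a × Phase))
    (i : Fin m) :
    lo i ≤ (deepPoly f lo hi A).l (inN a i) ∧ (deepPoly f lo hi A).u (inN a i) ≤ hi i := by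
  induction f with
  | input => exact ⟨le_clipL _ _ _, clipU_le _ _ _⟩
  | affine f W b ih => exact ih _
  | relu f ih => exact ih _

theorem deepPoly_active {a : Arch m n} (f : DNN a) (lo hi : Fin m → ℝ)
    {A : Set (Neuron a × Phase)} {ν : Neuron a} (h : (ν, Phase.active) ∈ A) :
    0 ≤ (deepPoly f lo hi A).l ν := by
  induction f with
  | input => exact clipL_nonneg h _
  | affine f W b ih =>
    rcases ν with ν | i
    · exact ih (ν := ν) h
    · exact clipL_nonneg h _
  | relu f ih =>
    rcases ν with ν | i
    · exact ih (ν := ν) h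
    · exact clipL_nonneg h _

theorem deepPoly_inactive {a : Arch m n} (f : DNN a) (lo hi : Fin m → ℝ)
    {A : Set (Neuron a × Phase)} {ν : Neuron a} (h : (ν, Phase.inactive) ∈ A) :
    (deepPoly f lo hi A).u ν ≤ 0 := by
  induction f with
  | input => exact clipU_nonpos h _
  | affine f W b ih =>
    rcases ν with ν | i
    · exact ih (ν := ν) h
    · exact clipU_nonpos h _
  | relu f ih =>
    rcases ν with ν | i
    · exact ih (ν := ν) h
    · exact clipU_nonpos h _

end Traces

/-! ### The encoding of counterexamples -/

section Encoding

variable {m n : ℕ} {a : Arch m n} {S : Spec m n}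

/-- The neuron values `y` of the network on an input in `X` with an output in `¬P` satisfy the
assertions `A`. -/
def Counterexample (f : DNN a) (S : Spec m n) (A : Set (Assertion a)) (y : Neuron a → ℝ) : Prop :=
  f.IsTrace y ∧ (fun i => y (inN a i)) ∈ S.X ∧ (fun i => y (outN a i)) ∈ S.negP ∧
    ∀ Q ∈ A, Assertion.Sat Q y

theorem not_safetyHolds_iff (f : DNN a) :
    ¬ SafetyHolds f.eval S.X S.P ↔ ∃ y, Counterexample f S ∅ y := by
  rw [SafetyHolds]
  push Not
  constructor
  · rintro ⟨x, hx, hP⟩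
    obtain ⟨y, hy, hyx⟩ := f.exists_isTrace x
    obtain rfl : (fun i => y (inN a i)) = x := funext hyx
    rw [hy.eval_eq, Spec.P, Set.notMem_compl_iff] at hP
    exact ⟨y, hy, hx, hP, by simp⟩
  · rintro ⟨y, hy, hx, hP, -⟩
    refine ⟨_, hx, ?_⟩
    rw [hy.eval_eq, Spec.P, Set.notMem_compl_iff]
    exact hP

theorem Counterexample.mem_deepPolySet {f : DNN a} {A : Set (Assertion a)} {y : Neuron a → ℝ}
    (h : Counterexample f S A y) : y ∈ deepPolySet f S := by
  obtain ⟨-, hb⟩ := h.1.deepPoly_sound h.2.1.1 (A := ∅) (by simp)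
  refine ⟨hb, h.1.1, fun r => ?_⟩
  obtain ⟨hl, hu⟩ := hb (pre r)
  rw [h.1.2 r]
  exact ⟨lowSlope_mul_le _ _ _, le_upSlope_mul_add hl hu⟩

/-- The equations of `slackTableau` say that the slack variables are the values of the linear
forms. -/
theorem slackTableau_sat_iff (f : DNN a) (x : Var a S → ℝ) :
    (slackTableau f S).Sat x ↔
      ∀ ρ, x (Sum.inr ρ) = ∑ ν, rowCoeff f S ρ ν * x (Sum.inl ν) := by
  have hrhs : ∀ ρ, (slackTableau f S).rhs (Sum.inr ρ) x =
      ∑ ν, rowCoeff f S ρ ν * x (Sum.inl ν) := by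
    intro ρ
    refine (Finset.sum_congr (s₂ := Finset.univ.filter fun z => ¬ z.isRight)
      (by ext; simp [slackTableau]) fun _ _ => rfl).trans ?_
    rw [Finset.sum_filter, Fintype.sum_sum_type]
    simp [slackTableau]
  constructor
  · intro h ρ
    rw [← hrhs]
    exact h _ (by simp [slackTableau])
  · rintro h (ν | ρ) hi
    · simp [slackTableau] at hi
    · rw [hrhs, h]

theorem sum_rowCoeff_relu (f : DNN a) (r : ReluIdx a) (y : Neuron a → ℝ) :
    ∑ ν, rowCoeff f S (.inr (.inl r)) ν * y ν = y (post r) - y (pre r) := by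
  simp [rowCoeff, sub_mul, Finset.sum_sub_distrib]

theorem sum_rowCoeff_in (f : DNN a) (k : Fin S.p) (y : Neuron a → ℝ) :
    ∑ ν, rowCoeff f S (.inr (.inr (.inl k))) ν * y ν = ∑ i, S.inMat k i * y (inN a i) :=
  sum_ite_mul (inN a) (S.inMat k) y

theorem sum_rowCoeff_out (f : DNN a) (k : Fin S.q) (y : Neuron a → ℝ) :
    ∑ ν, rowCoeff f S (.inr (.inr (.inr k))) ν * y ν = ∑ i, S.outMat k i * y (outN a i) :=
  sum_ite_mul (outN a) (S.outMat k) y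

/-- The solutions of the Reluplex encoding under assertions are the counterexamples that
satisfy these assertions. -/
theorem encoding_iff_counterexample (f : DNN a) (A : Set (Assertion a)) {x : Var a S → ℝ}
    (hx : (slackTableau f S).Sat x) :
    ((∀ r : ReluIdx a, x (nv S (post r)) = max 0 (x (nv S (pre r)))) ∧
      ∀ z, lowerB f S A z ≤ x z ∧ x z ≤ upperB f S A z) ↔
    Counterexample f S A (fun ν => x (nv S ν)) := by
  rw [slackTableau_sat_iff] at hx
  constructor
  · rintro ⟨hR, hb⟩
    have hν : ∀ ν, (deepPoly f S.lo S.hi A).l ν ≤ x (nv S ν) ∧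
      x (nv S ν) ≤ (deepPoly f S.lo S.hi A).u ν := fun ν => hb (Sum.inl ν)
    refine ⟨⟨fun e => ?_, hR⟩, ⟨fun i => ?_, fun k => ?_⟩, fun k => ?_, ?_⟩
    · have h1 : -affBias f e ≤ _ ∧ _ ≤ -affBias f e := hb (Sum.inr (Sum.inl e))
      exact (hx (Sum.inl e)).symm.trans (le_antisymm h1.2 h1.1)
    · have := deepPoly_box f S.lo S.hi A i
      exact ⟨this.1.trans (hν _).1, (hν _).2.trans this.2⟩
    · rw [← sum_rowCoeff_in f k (fun ν => x (nv S ν)), ← hx]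
      exact (hb _).2
    · rw [← sum_rowCoeff_out f k (fun ν => x (nv S ν)), ← hx]
      exact (hb _).2
    · rintro ⟨ν, _ | _⟩ hQ
      · exact (deepPoly_active f S.lo S.hi hQ).trans (hν ν).1
      · exact (hν ν).2.trans (deepPoly_inactive f S.lo S.hi hQ)
  · rintro ⟨htr, hX, hP, hA⟩
    obtain ⟨-, hν⟩ := htr.deepPoly_sound hX.1 hA
    refine ⟨htr.2, ?_⟩
    rintro (ν | e | r | k | k)
    · exact hν ν
    · have : x (Sum.inr (Sum.inl e)) = -affBias f e := (hx _).trans (htr.1 e)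
      exact ⟨this.ge, this.le⟩
    · have : x (Sum.inr (Sum.inr (Sum.inl r))) = max 0 (x (nv S (pre r))) - x (nv S (pre r)) := by
        rw [hx, sum_rowCoeff_relu f r (fun ν => x (nv S ν))]
        exact congrArg (· - _) (htr.2 r)
      rw [this]
      refine ⟨sub_nonneg.2 (le_max_right _ _), ?_⟩
      have hl := (hν (pre r)).1
      change _ ≤ max 0 (-(deepPoly f S.lo S.hi A).l (pre r))
      rcases le_total 0 (x (nv S (pre r))) with h | h
      · rw [max_eq_right h, sub_self]; exact le_max_left _ _
      · rw [max_eq_left h, zero_sub]; exact le_max_of_le_right (neg_le_neg hl)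
    · rw [hx]
      exact ⟨boxMin_le hν, (sum_rowCoeff_in f k (fun ν => x (nv S ν))).trans_le (hX.2 k)⟩
    · rw [hx]
      exact ⟨boxMin_le hν, (sum_rowCoeff_out f k (fun ν => x (nv S ν))).trans_le (hP k)⟩

theorem lowerB_active (f : DNN a) {A : Set (Assertion a)} {ν : Neuron a}
    (h : (ν, Phase.active) ∈ A) : 0 ≤ lowerB f S A (nv S ν) :=
  deepPoly_active f S.lo S.hi h

theorem upperB_inactive (f : DNN a) {A : Set (Assertion a)} {ν : Neuron a}
    (h : (ν, Phase.inactive) ∈ A) : upperB f S A (nv S ν) ≤ 0 :=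
  deepPoly_inactive f S.lo S.hi h

theorem exists_slackTableau_sat (f : DNN a) (S : Spec m n) (y : Neuron a → ℝ) :
    ∃ x, (slackTableau f S).Sat x ∧ (fun ν => x (nv S ν)) = y :=
  ⟨Sum.elim y fun ρ => ∑ ν, rowCoeff f S ρ ν * y ν,
    (slackTableau_sat_iff f _).2 fun _ => rfl, rfl⟩

end Encoding

/-! ### Correctness and existence of complete Reluplex searches -/

section Search

variable {m n : ℕ} {a : Arch m n} {S : Spec m n}

/-- The assignment `x` satisfies the constraints of the configuration. -/
def State.Models (C : State (Var a S)) (x : Var a S → ℝ) : Prop :=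
  C.tab.Sat x ∧ (∀ p ∈ C.R, x p.2 = max 0 (x p.1)) ∧ ∀ z, C.l z ≤ x z ∧ x z ≤ C.u z

/-- The configuration consists of the equations and the ReLU relations of `f` and of bounds that
are at least as tight as those of DeepPoly under the assertions `A`. -/
structure State.Encodes (f : DNN a) (A : Set (Assertion a)) (C : State (Var a S)) : Prop where
  tab : ∀ x, C.tab.Sat x ↔ (slackTableau f S).Sat x
  R : C.R = Set.range fun r : ReluIdx a => (nv S (pre r), nv S (post r))
  l : ∀ z, lowerB f S A z ≤ C.l z
  u : ∀ z, C.u z ≤ upperB f S A z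

theorem State.Encodes.models_iff {f : DNN a} {A : Set (Assertion a)} {C : State (Var a S)}
    (hC : C.Encodes f A) (x : Var a S → ℝ) :
    C.Models x ↔ (slackTableau f S).Sat x ∧ Counterexample f S A (fun ν => x (nv S ν)) ∧
      ∀ z, C.l z ≤ x z ∧ x z ≤ C.u z := by
  have hR : (∀ p ∈ C.R, x p.2 = max 0 (x p.1)) ↔
      ∀ r : ReluIdx a, x (nv S (post r)) = max 0 (x (nv S (pre r))) := by
    rw [hC.R, Set.forall_mem_range]
  rw [State.Models, hC.tab, hR]
  constructor
  · rintro ⟨h1, h2, h3⟩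
    exact ⟨h1, (encoding_iff_counterexample f A h1).1
      ⟨h2, fun z => ⟨(hC.l z).trans (h3 z).1, (h3 z).2.trans (hC.u z)⟩⟩, h3⟩
  · rintro ⟨h1, h2, h3⟩
    exact ⟨h1, ((encoding_iff_counterexample f A h1).2 h2).1, h3⟩

theorem State.Encodes.slack_eq {f : DNN a} {A : Set (Assertion a)} {C : State (Var a S)}
    (hC : C.Encodes f A) {x : Var a S → ℝ} (hx : C.tab.Sat x) (r : ReluIdx a) :
    x (reluSlack S r) = x (nv S (post r)) - x (nv S (pre r)) :=
  ((slackTableau_sat_iff f x).1 ((hC.tab x).1 hx) _).trans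
    (sum_rowCoeff_relu f r fun ν => x (nv S ν))

/-- Tighter bounds that hold for all solutions do not change the solutions. -/
theorem State.models_iff_of_tighten {C D : State (Var a S)} (htab : D.tab = C.tab) (hR : D.R = C.R)
    (hl : ∀ z, C.l z ≤ D.l z) (hu : ∀ z, D.u z ≤ C.u z)
    (h : ∀ x, C.Models x → ∀ z, D.l z ≤ x z ∧ x z ≤ D.u z) (x : Var a S → ℝ) :
    D.Models x ↔ C.Models x := by
  refine ⟨fun ⟨h1, h2, h3⟩ => ⟨htab ▸ h1, hR ▸ h2, fun z => ?_⟩,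
    fun hx => ⟨htab ▸ hx.1, hR ▸ hx.2.1, h x hx⟩⟩
  exact ⟨(hl z).trans (h3 z).1, (h3 z).2.trans (hu z)⟩

theorem State.Encodes.step {f : DNN a} {A : Set (Assertion a)} {C D : State (Var a S)}
    (hC : C.Encodes f A) (h : Step C D) : D.Encodes f A ∧ ∀ x, D.Models x ↔ C.Models x := by
  have hrelu : ∀ x, C.Models x → ∀ r : ReluIdx a, x (nv S (post r)) = max 0 (x (nv S (pre r))) :=
    fun x hx r => hx.2.1 (nv S (pre r), nv S (post r)) (hC.R ▸ ⟨r, rfl⟩)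
  cases h with
  | pivot i k hi hk hik =>
    have hp := C.tab.pivot_sat_iff hi hk hik
    exact ⟨⟨fun x => (hp x).trans (hC.tab x), hC.R, hC.l, hC.u⟩, fun x => and_congr_left' (hp x)⟩
  | update x => exact ⟨⟨hC.tab, hC.R, hC.l, hC.u⟩, fun _ => Iff.rfl⟩
  | active r h =>
    have hu : ∀ z, Function.update C.u (reluSlack S r) (min (C.u (reluSlack S r)) 0) z ≤ C.u z := by
      intro z
      rw [Function.update_apply]
      split_ifs with hz
      exacts [hz ▸ min_le_left _ _, le_rfl]
    refine ⟨⟨hC.tab, hC.R, hC.l, fun z => (hu z).trans (hC.u z)⟩,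
      State.models_iff_of_tighten rfl rfl (fun _ => le_rfl) hu fun x hx z => ⟨(hx.2.2 z).1, ?_⟩⟩
    dsimp only
    rw [Function.update_apply]
    split_ifs with hz
    · rw [hz]
      refine le_min (hx.2.2 _).2 ?_
      rw [hC.slack_eq hx.1, hrelu x hx r, max_eq_right (h.trans (hx.2.2 _).1), sub_self]
    · exact (hx.2.2 z).2
  | inactive r h =>
    have hl : ∀ z, C.l z ≤ Function.update C.l (nv S (post r)) (max (C.l (nv S (post r))) 0) z := by
      intro z
      rw [Function.update_apply]
      split_ifs with hz
      exacts [hz ▸ le_max_left _ _, le_rfl]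
    have hu : ∀ z, Function.update C.u (nv S (post r)) (min (C.u (nv S (post r))) 0) z ≤ C.u z := by
      intro z
      rw [Function.update_apply]
      split_ifs with hz
      exacts [hz ▸ min_le_left _ _, le_rfl]
    refine ⟨⟨hC.tab, hC.R, fun z => (hC.l z).trans (hl z), fun z => (hu z).trans (hC.u z)⟩,
      State.models_iff_of_tighten rfl rfl hl hu fun x hx z => ?_⟩
    have h0 : x (nv S (post r)) = 0 := by
      rw [hrelu x hx r, max_eq_left ((hx.2.2 _).2.trans h)]
    dsimp only
    rw [Function.update_apply, Function.update_apply]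
    split_ifs with hz
    · rw [hz]
      exact ⟨max_le (hx.2.2 _).1 h0.ge, le_min (hx.2.2 _).2 h0.le⟩
    · exact hx.2.2 z

theorem LocalSearch.forall_mem {C D : State (Var a S)} {cs : List (State (Var a S))}
    (h : LocalSearch C D cs) {p : State (Var a S) → Prop} (hC : p C)
    (hp : ∀ E E', Step E E' → p E → p E') : ∀ E ∈ cs, p E := by
  refine List.IsChain.induction p cs h.1 (fun E E' => hp E E') fun hne => ?_
  have := h.2.1
  rw [List.head?_eq_some_head hne, Option.some.injEq] at this
  rwa [this]

theorem LocalSearch.encodes {f : DNN a} {A : Set (Assertion a)} {C D : State (Var a S)}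
    {cs : List (State (Var a S))} (h : LocalSearch C D cs) (hC : C.Encodes f A) :
    D.Encodes f A ∧ ∀ x, D.Models x ↔ C.Models x :=
  h.forall_mem (p := fun E => E.Encodes f A ∧ ∀ x, E.Models x ↔ C.Models x)
    ⟨hC, fun _ => Iff.rfl⟩
    (fun _ _ hs hE => ⟨(hE.1.step hs).1, fun x => ((hE.1.step hs).2 x).trans (hE.2 x)⟩)
    D (List.mem_of_getLast? h.2.2)

theorem exists_localSearch {C D : State (Var a S)} (h : Relation.ReflTransGen Step C D) :
    ∃ cs, LocalSearch C D cs := by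
  obtain ⟨cs, h1, h2⟩ := List.exists_isChain_cons_of_relationReflTransGen h
  exact ⟨C :: cs, h1, rfl, by rw [List.getLast?_eq_some_getLast (List.cons_ne_nil _ _), h2]⟩

theorem State.Encodes.refine {f : DNN a} {A : Set (Assertion a)} {C : State (Var a S)}
    (hC : C.Encodes f A) (A' : Finset (Assertion a)) : (C.refine f A').Encodes f A' :=
  ⟨hC.tab, hC.R, fun _ => le_max_right _ _, fun _ => min_le_right _ _⟩

/-- The solutions after a split are those that satisfy the assertions. -/
theorem State.Encodes.refine_models_iff {f : DNN a} {A : Set (Assertion a)} {C : State (Var a S)}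
    (hC : C.Encodes f A) (A' : Finset (Assertion a)) (x : Var a S → ℝ) :
    (C.refine f A').Models x ↔
      C.Models x ∧ ∀ Q ∈ A', Assertion.Sat Q (fun ν => x (nv S ν)) := by
  constructor
  · intro h
    refine ⟨⟨h.1, h.2.1, fun z => ?_⟩, ?_⟩
    · exact ⟨(le_max_left _ _).trans (h.2.2 z).1, (h.2.2 z).2.trans (min_le_left _ _)⟩
    · exact (((hC.refine A').models_iff x).1 h).2.1.2.2.2
  · rintro ⟨h, hA⟩
    obtain ⟨h1, h2, h3⟩ := (hC.models_iff x).1 h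
    have := ((encoding_iff_counterexample f (A' : Set (Assertion a)) h1).2
      ⟨h2.1, h2.2.1, h2.2.2.1, hA⟩).2
    exact ⟨h.1, h.2.1, fun z => ⟨max_le (h3 z).1 (this z).1, le_min (h3 z).2 (this z).2⟩⟩

theorem State.not_models_of_isUnsat {C : State (Var a S)} (h : C.IsUnsat) (x : Var a S → ℝ) :
    ¬ C.Models x := by
  rintro ⟨h1, -, h3⟩
  rcases h with ⟨i, hi⟩ | ⟨z, hz⟩
  · exact hi.not_sat h3 h1
  · linarith [(h3 z).1, (h3 z).2]

theorem State.Encodes.sat_assertions {f : DNN a} {A : Set (Assertion a)} {C : State (Var a S)}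
    (hC : C.Encodes f A) {x : Var a S → ℝ} (hx : C.Models x) :
    ∀ Q ∈ A, Assertion.Sat Q (fun ν => x (nv S ν)) :=
  ((hC.models_iff x).1 hx).2.1.2.2.2

/-- Every solution is a solution of one of the two branches of a split. -/
theorem State.Encodes.models_refine_or {f : DNN a} {A : Finset (Assertion a)}
    {C : State (Var a S)} (hC : C.Encodes f A) (ν : Neuron a) {x : Var a S → ℝ}
    (hx : C.Models x) :
    (C.refine f (insert (ν, .inactive) A)).Models x ∨
      (C.refine f (insert (ν, .active) A)).Models x := by
  have hA := hC.sat_assertions hx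
  simp only [hC.refine_models_iff, Finset.forall_mem_insert]
  rcases le_total (x (nv S ν)) 0 with h | h
  · exact Or.inl ⟨hx, h, hA⟩
  · exact Or.inr ⟨hx, h, hA⟩

/-- The output of a complete search is correct. -/
theorem Solving.sat_iff {f : DNN a} {A : Finset (Assertion a)} {C : State (Var a S)}
    {t : Tree a S} {ans : Answer} (h : Solving f A C t ans) (hC : C.Encodes f A) :
    ans = .sat ↔ ∃ x, C.Models x := by
  -- a solution after a split is a solution before it
  have up : ∀ {A : Finset (Assertion a)} {C D : State (Var a S)} {cs} (A' : Finset (Assertion a)),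
      LocalSearch C D cs → C.Encodes f A → (∃ x, (D.refine f A').Models x) →
      ∃ x, C.Models x := by
    rintro A C D cs A' hs hC ⟨x, hx⟩
    obtain ⟨hD, hm⟩ := hs.encodes hC
    exact ⟨x, (hm x).1 ((hD.refine_models_iff A' x).1 hx).1⟩
  induction h with
  | @sat A C D cs hs hD =>
    exact iff_of_true rfl ⟨D.α, ((hs.encodes hC).2 _).1 hD⟩
  | @unsat A C D cs hs hD =>
    refine iff_of_false (by simp) ?_
    rintro ⟨x, hx⟩
    exact State.not_models_of_isUnsat hD x (((hs.encodes hC).2 x).2 hx)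
  | @split_unsat A C D cs x t t' hs hx _ _ ih ih' =>
    obtain ⟨hD, hm⟩ := hs.encodes hC
    refine iff_of_false (by simp) ?_
    rintro ⟨y, hy⟩
    rcases hD.models_refine_or x ((hm y).2 hy) with h | h
    · exact absurd ((ih (hD.refine _)).2 ⟨y, h⟩) (by simp)
    · exact absurd ((ih' (hD.refine _)).2 ⟨y, h⟩) (by simp)
  | split_sat_first hs hx _ ih =>
    exact iff_of_true rfl (up _ hs hC ((ih ((hs.encodes hC).1.refine _)).1 rfl))
  | split_sat_second hs hx _ _ _ ih =>
    exact iff_of_true rfl (up _ hs hC ((ih ((hs.encodes hC).1.refine _)).1 rfl))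
  | split_sat_first' hs hx _ ih =>
    exact iff_of_true rfl (up _ hs hC ((ih ((hs.encodes hC).1.refine _)).1 rfl))
  | split_sat_second' hs hx _ _ _ ih =>
    exact iff_of_true rfl (up _ hs hC ((ih ((hs.encodes hC).1.refine _)).1 rfl))

/-- The bounds decide the ReLU relation and make it linear. -/
def State.Decided (C : State (Var a S)) (r : ReluIdx a) : Prop :=
  (0 ≤ C.l (nv S (pre r)) ∧ C.u (reluSlack S r) ≤ 0) ∨
    (C.u (nv S (pre r)) ≤ 0 ∧ 0 ≤ C.l (nv S (post r)) ∧ C.u (nv S (post r)) ≤ 0)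

theorem State.exists_decided (C : State (Var a S)) (h : ∀ ν, ¬ C.Uncertain ν)
    (s : Finset (ReluIdx a)) :
    ∃ D, Relation.ReflTransGen Step C D ∧ (∀ z, C.l z ≤ D.l z) ∧ (∀ z, D.u z ≤ C.u z) ∧
      ∀ r ∈ s, D.Decided r := by
  induction s using Finset.induction_on with
  | empty => exact ⟨C, .refl, fun _ => le_rfl, fun _ => le_rfl, by simp⟩
  | insert r s _ ih =>
    obtain ⟨D, hD, hl, hu, hs⟩ := ih
    obtain ⟨E, hE, hl', hu', hr⟩ : ∃ E, Step D E ∧ (∀ z, D.l z ≤ E.l z) ∧ (∀ z, E.u z ≤ D.u z) ∧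
        E.Decided r := by
      by_cases h0 : 0 ≤ C.l (nv S (pre r))
      · refine ⟨_, .active D r (h0.trans (hl _)), fun z => le_rfl, fun z => ?_,
          Or.inl ⟨h0.trans (hl _), by simp⟩⟩
        dsimp only
        rw [Function.update_apply]
        split_ifs with hz
        exacts [hz ▸ min_le_left _ _, le_rfl]
      · have h1 : C.u (nv S (pre r)) ≤ 0 := by
          by_contra h2
          exact h (pre r) ⟨⟨r, rfl⟩, not_le.1 h0, not_le.1 h2⟩
        have hu' : ∀ z, Function.update D.u (nv S (post r)) (min (D.u (nv S (post r))) 0) z ≤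
            D.u z := by
          intro z
          rw [Function.update_apply]
          split_ifs with hz
          exacts [hz ▸ min_le_left _ _, le_rfl]
        refine ⟨_, .inactive D r ((hu _).trans h1), fun z => ?_, hu',
          Or.inr ⟨(hu' _).trans ((hu _).trans h1), by simp, by simp⟩⟩
        dsimp only
        rw [Function.update_apply]
        split_ifs with hz
        exacts [hz ▸ le_max_left _ _, le_rfl]
    refine ⟨E, hD.tail hE, fun z => (hl z).trans (hl' z), fun z => (hu' z).trans (hu z), ?_⟩
    rw [Finset.forall_mem_insert]
    refine ⟨hr, fun r' hr' => ?_⟩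
    rcases hs r' hr' with ⟨h1, h2⟩ | ⟨h1, h2, h3⟩
    · exact Or.inl ⟨h1.trans (hl' _), (hu' _).trans h2⟩
    · exact Or.inr ⟨(hu' _).trans h1, h2.trans (hl' _), (hu' _).trans h3⟩

/-- If the bounds decide all ReLU relations, then these follow from the equations and bounds. -/
theorem State.Encodes.models_of_decided {f : DNN a} {A : Set (Assertion a)} {C : State (Var a S)}
    (hC : C.Encodes f A) (h : ∀ r, C.Decided r) {x : Var a S → ℝ} (hx : C.tab.Sat x)
    (hb : ∀ z, C.l z ≤ x z ∧ x z ≤ C.u z) : C.Models x := by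
  refine ⟨hx, ?_, hb⟩
  rw [hC.R, Set.forall_mem_range]
  intro r
  change x (nv S (post r)) = max 0 (x (nv S (pre r)))
  rcases h r with ⟨h1, h2⟩ | ⟨h1, h2, h3⟩
  · have hs := hC.slack_eq hx r
    have h0 : (0 : ℝ) ≤ C.l (reluSlack S r) := hC.l (reluSlack S r)
    have hb' := hb (reluSlack S r)
    rw [max_eq_right (h1.trans (hb _).1)]
    linarith
  · rw [max_eq_left ((hb _).2.trans h1)]
    exact le_antisymm ((hb _).2.trans h3) (h2.trans (hb _).1)

theorem reflTransGen_step_of_pivots {t t' : Tableau (Var a S)}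
    (h : Relation.ReflTransGen Tableau.PivotStep t t') (C : State (Var a S)) (hC : C.tab = t) :
    Relation.ReflTransGen Step C { C with tab := t' } := by
  subst hC
  induction h with
  | refl => exact .refl
  | tail _ hs ih =>
    obtain ⟨i, hi, k, hk, hik, rfl⟩ := hs
    exact ih.tail (.pivot _ i k hi hk hik)

/-- A configuration without solutions and without uncertain ReLU arguments has a local search to
`UNSAT`. -/
theorem State.Encodes.exists_isUnsat {f : DNN a} {A : Set (Assertion a)} {C : State (Var a S)}
    (hC : C.Encodes f A) (hno : ∀ x, ¬ C.Models x) (h : ∀ ν, ¬ C.Uncertain ν) :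
    ∃ D cs, LocalSearch C D cs ∧ D.IsUnsat := by
  obtain ⟨D, hCD, -, -, hdec⟩ := C.exists_decided h Finset.univ
  obtain ⟨cs, hcs⟩ := exists_localSearch hCD
  obtain ⟨hD, hm⟩ := hcs.encodes hC
  by_cases hlu : ∃ z, D.u z < D.l z
  · exact ⟨D, cs, hcs, Or.inr hlu⟩
  push Not at hlu
  obtain ⟨t, ht, hconf⟩ := D.tab.exists_pivots_of_infeasible hlu fun x hx hb =>
    hno x ((hm x).1 (hD.models_of_decided (fun r => hdec r (Finset.mem_univ r)) hx hb))
  obtain ⟨cs', hcs'⟩ := exists_localSearch (hCD.trans (reflTransGen_step_of_pivots ht D rfl))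
  exact ⟨_, cs', hcs', Or.inl hconf⟩

theorem LocalSearch.refl (C : State (Var a S)) : LocalSearch C C [C] :=
  ⟨.singleton _, rfl, rfl⟩

/-- A configuration without solutions has a complete search: split on uncertain ReLU arguments
as long as there are any; every split makes one more argument certain. -/
theorem State.Encodes.exists_solving_unsat {f : DNN a} (N : ℕ) :
    ∀ {A : Finset (Assertion a)} {C : State (Var a S)}, C.Encodes f A →
      (∀ x, ¬ C.Models x) → (Finset.univ.filter fun ν => C.Uncertain ν).card = N →
      ∃ t, Solving f A C t .unsat := by
  induction N using Nat.strong_induction_on with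
  | _ N ih =>
  intro A C hC hno hN
  by_cases h : ∃ ν, C.Uncertain ν
  · obtain ⟨ν, hν⟩ := h
    have hlt : ∀ A' : Finset (Assertion a), ¬ (C.refine f A').Uncertain ν →
        (Finset.univ.filter fun z => (C.refine f A').Uncertain z).card < N := by
      intro A' hA'
      rw [← hN]
      refine Finset.card_lt_card (Finset.ssubset_iff_subset_ne.2 ⟨fun z hz => ?_, fun he => hA' ?_⟩)
      · simp only [Finset.mem_filter, Finset.mem_univ, true_and] at hz ⊢
        exact ⟨hz.1, (le_max_left _ _).trans_lt hz.2.1, hz.2.2.trans_le (min_le_left _ _)⟩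
      · have : ν ∈ Finset.univ.filter fun z => C.Uncertain z := by simpa using hν
        rw [← he] at this
        simpa using this
    have hno' : ∀ A' x, ¬ (C.refine f A').Models x := fun A' x hx =>
      hno x ((hC.refine_models_iff A' x).1 hx).1
    have hi : ¬ (C.refine f (insert (ν, .inactive) A)).Uncertain ν := fun h =>
      absurd (h.2.2.trans_le ((min_le_right _ _).trans (upperB_inactive f (by simp)))) (lt_irrefl _)
    have ha : ¬ (C.refine f (insert (ν, .active) A)).Uncertain ν := fun h =>
      absurd (((lowerB_active f (by simp)).trans (le_max_right _ _)).trans_lt h.2.1) (lt_irrefl _)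
    obtain ⟨t, ht⟩ := ih _ (hlt _ hi) (hC.refine _) (hno' _) rfl
    obtain ⟨t', ht'⟩ := ih _ (hlt _ ha) (hC.refine _) (hno' _) rfl
    exact ⟨_, .split_unsat (LocalSearch.refl C) hν ht ht'⟩
  · push Not at h
    obtain ⟨D, cs, hcs, hD⟩ := hC.exists_isUnsat hno h
    exact ⟨_, .unsat hcs hD⟩

theorem State.Encodes.exists_solving {f : DNN a} {A : Finset (Assertion a)}
    {C : State (Var a S)} (hC : C.Encodes f A) : ∃ t ans, Solving f A C t ans := by
  by_cases h : ∃ x, C.Models x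
  · obtain ⟨x, hx⟩ := h
    refine ⟨_, _, .sat (exists_localSearch (.single (.update C x))).choose_spec ?_⟩
    change C.Models (C.tab.extend x)
    rwa [Tableau.extend_eq_self hx.1]
  · push Not at h
    obtain ⟨t, ht⟩ := State.Encodes.exists_solving_unsat _ hC h rfl
    exact ⟨t, _, ht⟩

/-- Reluplex decides whether a configuration of the network has a solution. -/
theorem IsReluplex.sat_iff {f : DNN a}
    {reluplex : Finset (Assertion a) → State (Var a S) → Answer} (hr : IsReluplex f S reluplex)
    {A : Finset (Assertion a)} {C : State (Var a S)} (hC : C.Encodes f A) :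
    reluplex A C = .sat ↔ ∃ x, C.Models x := by
  obtain ⟨t, ht⟩ := hr A C hC.exists_solving
  exact ht.sat_iff hC

end Search

/-! ### The leaves of a solving procedure -/

section Leaves

variable {m n : ℕ} {a : Arch m n} {S : Spec m n}

theorem LocalSearch.R_eq {C D : State (Var a S)} {cs : List (State (Var a S))}
    (h : LocalSearch C D cs) : ∀ E ∈ cs, E.R = C.R :=
  h.forall_mem (p := fun E => E.R = C.R) rfl fun _ _ hs hE => by cases hs <;> exact hE

/-- All configurations in the label of the leaf have the ReLU relations `R`. -/
def Leaf.HasR (R : Set (Var a S × Var a S)) (v : Leaf a S) : Prop :=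
  ∀ C, Config.state C ∈ v.label → C.R = R

theorem Solving.hasR {f : DNN a} {A : Finset (Assertion a)} {C : State (Var a S)}
    {t : Tree a S} {ans : Answer} (h : Solving f A C t ans) (A' : Finset (Assertion a)) :
    ∀ v ∈ t.leaves A', v.HasR C.R := by
  have hrefine : ∀ {C D : State (Var a S)} {cs} (A : Finset (Assertion a)), LocalSearch C D cs →
      (D.refine f A).R = C.R := fun {_ D _} _ hs => hs.R_eq D (List.mem_of_getLast? hs.2.2)
  have hempty : ∀ (R : Set (Var a S × Var a S)) A', (⟨A', []⟩ : Leaf a S).HasR R :=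
    fun R A' C hC => by simp at hC
  induction h generalizing A' with
  | sat hs hD =>
    simp only [Tree.leaves, List.mem_singleton, forall_eq]
    intro E hE
    exact hs.R_eq E (by simpa using hE)
  | unsat hs hD =>
    simp only [Tree.leaves, List.mem_singleton, forall_eq]
    intro E hE
    exact hs.R_eq E (by simpa using hE)
  | split_unsat hs hx _ _ ih ih' =>
    rw [hrefine _ hs] at ih ih'
    exact List.forall_mem_append.2 ⟨ih _, ih' _⟩
  | split_sat_first hs hx _ ih =>
    rw [hrefine _ hs] at ih
    exact List.forall_mem_append.2 ⟨ih _, by simp [Tree.leaves, hempty]⟩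
  | split_sat_second hs hx _ _ ih ih' =>
    rw [hrefine _ hs] at ih ih'
    exact List.forall_mem_append.2 ⟨ih _, ih' _⟩
  | split_sat_first' hs hx _ ih =>
    rw [hrefine _ hs] at ih
    exact List.forall_mem_append.2 ⟨by simp [Tree.leaves, hempty], ih _⟩
  | split_sat_second' hs hx _ _ ih ih' =>
    rw [hrefine _ hs] at ih ih'
    exact List.forall_mem_append.2 ⟨ih' _, ih _⟩

theorem Leaf.HasR.last {R : Set (Var a S × Var a S)} {v : Leaf a S} (hv : v.HasR R)
    {C₀ : State (Var a S)} (h₀ : C₀.R = R) : (v.last C₀).R = R := by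
  rw [Leaf.last]
  generalize hL : (v.label.filterMap fun c => match c with
    | .state C => some C
    | _ => none) = L
  cases hlast : L.getLast? with
  | none => exact h₀
  | some C =>
    have hC := List.mem_of_getLast? hlast
    rw [← hL, List.mem_filterMap] at hC
    obtain ⟨c, hc, he⟩ := hC
    cases c with
    | sat => simp at he
    | unsat => simp at he
    | state D =>
      simp only [Option.some.injEq] at he
      exact hv C (he ▸ hc)

/-- A search whose output is `UNSAT` visits all leaves and ends in `UNSAT` at each of them; a
search whose output is `SAT` has a leaf that ends in `SAT`, and only such a search has leaves with
the empty label. -/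
theorem Solving.leaves_labels {f : DNN a} {A : Finset (Assertion a)} {C : State (Var a S)}
    {t : Tree a S} {ans : Answer} (h : Solving f A C t ans) (A' : Finset (Assertion a)) :
    (ans = .unsat → ∀ v ∈ t.leaves A', v.IsUnsatLeaf) ∧
      (ans = .sat → ∃ v ∈ t.leaves A', v.IsSatLeaf) ∧
      ∀ v ∈ t.leaves A', v.IsSatLeaf ∨ v.IsUnsatLeaf ∨ v.IsEmptyLeaf := by
  induction h generalizing A' with
  | sat hs hD => simp [Tree.leaves, Leaf.IsSatLeaf]
  | unsat hs hD => simp [Tree.leaves, Leaf.IsUnsatLeaf]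
  | split_unsat hs hx _ _ ih ih' =>
    simp only [Tree.leaves, List.mem_append]
    grind
  | @split_sat_first _ _ _ _ x _ hs hx _ ih =>
    have hempty : ∀ A : Finset (Assertion a), (⟨A, []⟩ : Leaf a S).IsEmptyLeaf := fun _ => rfl
    have := (ih (insert (x, .inactive) A')).2.1 rfl
    simp only [Tree.leaves, List.mem_append, List.mem_singleton]
    grind
  | @split_sat_second _ _ _ _ x _ _ hs hx _ _ ih ih' =>
    have := (ih' (insert (x, .active) A')).2.1 rfl
    simp only [Tree.leaves, List.mem_append]
    grind
  | @split_sat_first' _ _ _ _ x _ hs hx _ ih =>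
    have hempty : ∀ A : Finset (Assertion a), (⟨A, []⟩ : Leaf a S).IsEmptyLeaf := fun _ => rfl
    have := (ih (insert (x, .active) A')).2.1 rfl
    simp only [Tree.leaves, List.mem_append, List.mem_singleton]
    grind
  | @split_sat_second' _ _ _ _ x _ _ hs hx _ _ ih ih' =>
    have := (ih' (insert (x, .inactive) A')).2.1 rfl
    simp only [Tree.leaves, List.mem_append]
    grind

/-- The assertions of the leaves cover all values of the neurons. -/
theorem Tree.exists_leaf_sat (t : Tree a S) (A : Finset (Assertion a)) {y : Neuron a → ℝ}
    (hy : ∀ Q ∈ A, Assertion.Sat Q y) :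
    ∃ v ∈ t.leaves A, ∀ Q ∈ v.assert, Assertion.Sat Q y := by
  induction t generalizing A with
  | leaf lab => exact ⟨_, List.mem_singleton_self _, hy⟩
  | node lab x t t' ih ih' =>
    simp only [Tree.leaves, List.mem_append]
    rcases le_total (y x) 0 with h | h
    · obtain ⟨v, hv, hs⟩ := ih (insert (x, .inactive) A) (by
        rw [Finset.forall_mem_insert]; exact ⟨h, hy⟩)
      exact ⟨v, Or.inl hv, hs⟩
    · obtain ⟨v, hv, hs⟩ := ih' (insert (x, .active) A) (by
        rw [Finset.forall_mem_insert]; exact ⟨h, hy⟩)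
      exact ⟨v, Or.inr hv, hs⟩

end Leaves

/-! ### The incremental algorithm -/

section Algorithm

variable {m n : ℕ} {a : Arch m n} {S : Spec m n}

theorem Answer.eq_unsat_iff (ans : Answer) : ans = .unsat ↔ ans ≠ .sat := by
  cases ans <;> simp

theorem firstSat_eq_sat_iff (call : Leaf a S → Answer) (vs : List (Leaf a S)) :
    firstSat call vs = .sat ↔ ∃ v ∈ vs, call v = .sat := by
  induction vs with
  | nil => simp [firstSat]
  | cons v vs ih =>
    rw [firstSat]
    cases hv : call v <;> simp [hv, ih]

theorem Counterexample.mono {f : DNN a} {A A' : Set (Assertion a)} {y : Neuron a → ℝ}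
    (h : Counterexample f S A' y) (hA : A ⊆ A') : Counterexample f S A y :=
  ⟨h.1, h.2.1, h.2.2.1, fun Q hQ => h.2.2.2 Q (hA hQ)⟩

theorem initConfig_tab_gauss_sat_iff (f : DNN a) (B B' : Finset (Var a S)) (x : Var a S → ℝ) :
    ((initConfig f S B).tab.gauss B').Sat x ↔ (slackTableau f S).Sat x :=
  (Tableau.gauss_sat_iff _ _ x).trans (Tableau.gauss_sat_iff _ _ x)

/-- The linear relaxation contains the encoding of every counterexample. -/
theorem Counterexample.mem_lpSet {f : DNN a} {A : Finset (Assertion a)} {x : Var a S → ℝ}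
    (hx : (slackTableau f S).Sat x)
    (h : Counterexample f S (A : Set (Assertion a)) (fun ν => x (nv S ν))) : x ∈ lpSet f S A := by
  obtain ⟨hR, hb⟩ := (encoding_iff_counterexample f (A : Set (Assertion a)) hx).2 h
  refine ⟨hx, hb, fun r => ?_⟩
  dsimp only
  obtain ⟨hl, hu⟩ := hb (nv S (pre r))
  rw [hR r]
  split_ifs with h1 h2
  · exact max_eq_right (h1.trans hl)
  · exact max_eq_left (hu.trans h2)
  · refine ⟨le_max_left _ _, le_max_right _ _, ?_⟩
    have := le_upSlope_mul_add hl hu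
    rw [upSlope, upConst, if_neg h1, if_neg h1, if_neg h2, if_neg h2] at this
    refine this.trans_eq ?_
    ring

/-- A configuration of the network has a solution if and only if there is a counterexample,
provided that its bounds hold for all counterexamples. -/
theorem State.Encodes.exists_models_iff {f : DNN a} {A : Set (Assertion a)} {C : State (Var a S)}
    (hC : C.Encodes f A)
    (h : ∀ x, (slackTableau f S).Sat x → Counterexample f S A (fun ν => x (nv S ν)) →
      ∀ z, C.l z ≤ x z ∧ x z ≤ C.u z) :
    (∃ x, C.Models x) ↔ ∃ y, Counterexample f S A y := by
  constructor
  · rintro ⟨x, hx⟩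
    exact ⟨_, ((hC.models_iff x).1 hx).2.1⟩
  · rintro ⟨y, hy⟩
    obtain ⟨x, hx, rfl⟩ := exists_slackTableau_sat f S y
    exact ⟨x, (hC.models_iff x).2 ⟨hx, hy, h x hx hy⟩⟩

theorem solveOpen_eq_sat_iff {f : DNN a}
    {reluplex : Finset (Assertion a) → State (Var a S) → Answer} (hr : IsReluplex f S reluplex)
    (B : Finset (Var a S)) {v : Leaf a S} (hv : v.HasR (initConfig f S B).R) :
    solveOpen reluplex f (initConfig f S B) v = .sat ↔
      ∃ y, Counterexample f S (v.assert : Set (Assertion a)) y := by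
  rw [solveOpen]
  have hC : State.Encodes f (v.assert : Set (Assertion a))
      { v.last (initConfig f S B) with
        tab := (initConfig f S B).tab.gauss (v.last (initConfig f S B)).tab.basic
        l := lowerB f S ↑v.assert
        u := upperB f S ↑v.assert } :=
    ⟨initConfig_tab_gauss_sat_iff f B _, hv.last rfl, fun _ => le_rfl, fun _ => le_rfl⟩
  refine (hr.sat_iff hC).trans (hC.exists_models_iff fun x hx hy => ?_)
  exact ((encoding_iff_counterexample f _ hx).2 hy).2

theorem solve_eq_sat_iff {f : DNN a}
    {reluplex : Finset (Assertion a) → State (Var a S) → Answer} (hr : IsReluplex f S reluplex)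
    (B : Finset (Var a S)) {v : Leaf a S} (hv : v.HasR (initConfig f S B).R) :
    solve reluplex f (initConfig f S B) v = .sat ↔
      ∃ y, Counterexample f S (v.assert : Set (Assertion a)) y := by
  rw [solve]
  dsimp only
  have hlp : ∀ x ∈ lpSet f S v.assert, ∀ z,
      lowerB f S ↑v.assert z ≤ x z ∧ x z ≤ upperB f S ↑v.assert z := fun x hx => hx.2.1
  have hcex : ∀ y, Counterexample f S (v.assert : Set (Assertion a)) y →
      ∃ x ∈ lpSet f S v.assert, (slackTableau f S).Sat x ∧ (fun ν => x (nv S ν)) = y := by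
    intro y hy
    obtain ⟨x, hx, rfl⟩ := exists_slackTableau_sat f S y
    exact ⟨x, hy.mem_lpSet hx, hx, rfl⟩
  by_cases hempty : lpSet f S v.assert = ∅
  · rw [if_pos hempty]
    refine iff_of_false (by simp) ?_
    rintro ⟨y, hy⟩
    obtain ⟨x, hx, -⟩ := hcex y hy
    simp [hempty] at hx
  rw [if_neg hempty]
  have hne := Set.nonempty_iff_ne_empty.2 hempty
  -- the minima and maxima over the linear program lie within the bounds and hold on all of it
  have hinf : ∀ z, lowerB f S ↑v.assert z ≤ sInf ((fun y => y z) '' lpSet f S v.assert) :=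
    fun z => le_csInf (hne.image _) (by rintro _ ⟨x, hx, rfl⟩; exact (hlp x hx z).1)
  have hsup : ∀ z, sSup ((fun y => y z) '' lpSet f S v.assert) ≤ upperB f S ↑v.assert z :=
    fun z => csSup_le (hne.image _) (by rintro _ ⟨x, hx, rfl⟩; exact (hlp x hx z).2)
  have hinf' : ∀ x ∈ lpSet f S v.assert, ∀ z,
      sInf ((fun y => y z) '' lpSet f S v.assert) ≤ x z := fun x hx z =>
    csInf_le ⟨_, by rintro _ ⟨x, hx, rfl⟩; exact (hlp x hx z).1⟩ ⟨x, hx, rfl⟩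
  have hsup' : ∀ x ∈ lpSet f S v.assert, ∀ z,
      x z ≤ sSup ((fun y => y z) '' lpSet f S v.assert) := fun x hx z =>
    le_csSup ⟨_, by rintro _ ⟨x, hx, rfl⟩; exact (hlp x hx z).2⟩ ⟨x, hx, rfl⟩
  generalize (v.last (initConfig f S B)).starVars = V
  set l : Var a S → ℝ := fun z => if z ∈ V then sInf ((fun y => y z) '' lpSet f S v.assert)
    else lowerB f S ↑v.assert z with hl
  set u : Var a S → ℝ := fun z => if z ∈ V then sSup ((fun y => y z) '' lpSet f S v.assert)
    else upperB f S ↑v.assert z with hu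
  have hb : ∀ x ∈ lpSet f S v.assert, ∀ z, l z ≤ x z ∧ x z ≤ u z := by
    intro x hx z
    simp only [hl, hu]
    split_ifs
    exacts [⟨hinf' x hx z, hsup' x hx z⟩, hlp x hx z]
  split_ifs with hconf
  · obtain ⟨i, -, hi⟩ := hconf
    refine iff_of_false (by simp) ?_
    rintro ⟨y, hy⟩
    obtain ⟨x, hx, hsat, -⟩ := hcex y hy
    exact hi.not_sat (hb x hx) ((initConfig_tab_gauss_sat_iff f B _ x).2 hsat)
  · have hC : State.Encodes f (v.assert : Set (Assertion a))
        { v.last (initConfig f S B) with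
          tab := (initConfig f S B).tab.gauss (v.last (initConfig f S B)).tab.basic
          l := l
          u := u } := by
      refine ⟨initConfig_tab_gauss_sat_iff f B _, hv.last rfl, fun z => ?_, fun z => ?_⟩
      · simp only [hl]
        split_ifs
        exacts [hinf z, le_rfl]
      · simp only [hu]
        split_ifs
        exacts [hsup z, le_rfl]
    exact (hr.sat_iff hC).trans
      (hC.exists_models_iff fun x hx hy => hb x (hy.mem_lpSet hx))

/-- The algorithm returns `SAT` if and only if the modified network has a counterexample. -/
theorem verify_eq_sat_iff {f f' : DNN a} {𝒯 : Tree a S} (h𝒯 : IsSolvingProcedure f S 𝒯)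
    (B : Finset (Var a S)) {reluplex : Finset (Assertion a) → State (Var a S) → Answer}
    (hr : IsReluplex f' S reluplex) :
    verify reluplex B f' 𝒯 = .sat ↔ ∃ y, Counterexample f' S ∅ y := by
  obtain ⟨B₀, ans, hsol⟩ := h𝒯
  have hR : ∀ v ∈ 𝒯.leaves ∅, v.HasR (initConfig f' S B).R := hsol.hasR ∅
  obtain ⟨hunsat, hsat, hlabels⟩ := hsol.leaves_labels ∅
  rw [verify]
  dsimp only
  by_cases hU : {x ∈ deepPolySet f' S | (fun i => x (outN a i)) ∈ S.negP} = ∅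
  · rw [if_pos hU]
    refine iff_of_false (by simp) ?_
    rintro ⟨y, hy⟩
    have : y ∈ {x ∈ deepPolySet f' S | (fun i => x (outN a i)) ∈ S.negP} :=
      ⟨hy.mem_deepPolySet, hy.2.2.1⟩
    simp [hU] at this
  rw [if_neg hU]
  set pruned := (𝒯.leaves ∅).filter
    fun v => ∀ Q ∈ v.assert, {x ∈ deepPolySet f' S | Q.Sat x} ≠ ∅ with hpruned
  set openLeaves : List (Leaf a S) :=
    (match (𝒯.leaves ∅).find? (fun v => v.IsSatLeaf) with
      | none => []
      | some w => (pruned.filter fun v => v.IsSatLeaf ∨ v.IsEmptyLeaf).insertionSort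
          fun v v' => v.dist w ≤ v'.dist w) with hopen
  have hopen_sub : ∀ v ∈ openLeaves, v ∈ 𝒯.leaves ∅ := by
    intro v hv
    rw [hopen] at hv
    split at hv
    · simp at hv
    · rw [List.mem_insertionSort] at hv
      exact List.mem_of_mem_filter (List.mem_of_mem_filter hv)
  have hopen_mem : ∀ v ∈ pruned, v.IsSatLeaf ∨ v.IsEmptyLeaf → v ∈ openLeaves := by
    intro v hv hlab
    have hv' := List.mem_of_mem_filter hv
    obtain ⟨w, hw, hws⟩ : ∃ w ∈ 𝒯.leaves ∅, w.IsSatLeaf := by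
      refine hsat ?_
      cases ans with
      | sat => rfl
      | unsat =>
        exfalso
        have := hunsat rfl v hv'
        rw [Leaf.IsUnsatLeaf] at this
        rcases hlab with h | h
        · rw [Leaf.IsSatLeaf, this] at h; simp at h
        · rw [Leaf.IsEmptyLeaf] at h; simp [h] at this
    rw [hopen]
    split
    · rename_i hnone
      rw [List.find?_eq_none] at hnone
      exact absurd hws (by simpa using hnone w hw)
    · rw [List.mem_insertionSort, List.mem_filter]
      exact ⟨hv, by simpa using hlab⟩
  have hmatch : (match firstSat (solveOpen reluplex f' (initConfig f' S B)) openLeaves with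
      | .sat => Answer.sat
      | .unsat => firstSat (solve reluplex f' (initConfig f' S B))
          (pruned.filter fun v => v.IsUnsatLeaf)) = .sat ↔
      firstSat (solveOpen reluplex f' (initConfig f' S B)) openLeaves = .sat ∨
        firstSat (solve reluplex f' (initConfig f' S B))
          (pruned.filter fun v => v.IsUnsatLeaf) = .sat := by
    cases firstSat (solveOpen reluplex f' (initConfig f' S B)) openLeaves <;> simp
  refine hmatch.trans ?_
  rw [firstSat_eq_sat_iff, firstSat_eq_sat_iff]
  constructor
  · rintro (⟨v, hv, h⟩ | ⟨v, hv, h⟩)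
    · obtain ⟨y, hy⟩ := (solveOpen_eq_sat_iff hr B (hR v (hopen_sub v hv))).1 h
      exact ⟨y, hy.mono (Set.empty_subset _)⟩
    · have hv' := List.mem_of_mem_filter (List.mem_of_mem_filter hv)
      obtain ⟨y, hy⟩ := (solve_eq_sat_iff hr B (hR v hv')).1 h
      exact ⟨y, hy.mono (Set.empty_subset _)⟩
  · rintro ⟨y, hy⟩
    obtain ⟨v, hv, hs⟩ := 𝒯.exists_leaf_sat ∅ (y := y) (by simp)
    have hv' : v ∈ pruned := by
      rw [hpruned, List.mem_filter]
      refine ⟨hv, decide_eq_true fun Q hQ => ?_⟩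
      exact Set.nonempty_iff_ne_empty.1 ⟨y, hy.mem_deepPolySet, hs Q hQ⟩
    have hyv : Counterexample f' S (v.assert : Set (Assertion a)) y :=
      ⟨hy.1, hy.2.1, hy.2.2.1, hs⟩
    have hcases : (v.IsSatLeaf ∨ v.IsEmptyLeaf) ∨ v.IsUnsatLeaf := by
      rcases hlabels v hv with h | h | h
      exacts [Or.inl (Or.inl h), Or.inr h, Or.inl (Or.inr h)]
    rcases hcases with h | h
    · exact Or.inl ⟨v, hopen_mem v hv' h, (solveOpen_eq_sat_iff hr B (hR v hv)).2 ⟨y, hyv⟩⟩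
    · exact Or.inr ⟨v, List.mem_filter.2 ⟨hv', decide_eq_true h⟩,
        (solve_eq_sat_iff hr B (hR v hv)).2 ⟨y, hyv⟩⟩

end Algorithm

end IncSMT

theorem mainTheorem1 {m n : ℕ} {a : IncSMT.Arch m n} (f f' : IncSMT.DNN a)
    (S : IncSMT.Spec m n) (𝒯 : IncSMT.Tree a S) (h𝒯 : IncSMT.IsSolvingProcedure f S 𝒯)
    (B : Finset (IncSMT.Var a S))
    (reluplex : Finset (IncSMT.Assertion a) → IncSMT.State (IncSMT.Var a S) → IncSMT.Answer)
    (hr : IncSMT.IsReluplex f' S reluplex) :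
    IncSMT.verify reluplex B f' 𝒯 = .unsat ↔ IncSMT.SafetyHolds f'.eval S.X S.P := by
  rw [IncSMT.Answer.eq_unsat_iff, Ne, IncSMT.verify_eq_sat_iff h𝒯 B hr,
    ← IncSMT.not_safetyHolds_iff, not_not]
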